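/- **Conventions.** Let $J_k$ be the upper triangular $k\times k$ Jordan block with eigenvalue $1$, and write $A^*=\bar A^{T}$. A *simple hermitian variation structure* (with sign $\varepsilon=-1$) on $\mathbb C^r$ is a triple of matrices $(b,h,V)$ with $b^*=-b$, $h$ invertible, $h^*bh=b$, $V$ invertible, $V^*=Vh^*$ and $Vb=h-I$. Two such structures $(b,h,V)$, $(b',h',V')$ are isomorphic if there is an invertible $\phi$ with $b=\phi^*b'\phi$, $h=\phi^{-1}h'\phi$, $V=\phi^{-1}V'(\phi^*)^{-1}$. Consider the following structures. * For $0<|\lambda|<1$ and $k\ge1$, $\mathcal V^{2k}_\lambda$ on $\mathbb C^{2k}$ has $b=\begin{pmatrix}0&I\\-I&0\end{pmatrix}$, $h=\begin{pmatrix}\lambda J_k&0\\0&\bar\lambda^{-1}(J_k^*)^{-1}\end{pmatrix}$, $V=\begin{pmatrix}0&-(\lambda J_k-I)\\ \bar\lambda^{-1}(J_k^*)^{-1}-I&0\end{pmatrix}$. * For $k\ge1$, $u=\pm1$, let $b^k_u$ be an invertible $k\times k$ matrix with $(b^k_u)^*=-b^k_u$, $J_k^*b^k_uJ_k=b^k_u$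 and $(b^k_u)_{1,k}=u\,i^{-k}$. For $|\lambda|=1$, $\lambda\ne1$, put $\mathcal W^k_\lambda(u)=\bigl(b^k_u,\ \lambda J_k,\ (\lambda J_k-I)(b^k_u)^{-1}\bigr)$. * For $\lambda=1$, $k\ge1$, $u=\pm1$, $\mathcal W^k_1(u)$ is a simple structure on $\mathbb C^k$ with $h=J_k$, $b=0\oplus b^{k-1}_u$ (with $0$ of size $1\times1$) and $(V^{-1})_{1,k}=u\,i^{-1-k}$. The choices left open here do not affect the isomorphism class. The *H-numbers* $q^k_\lambda$ ($k\ge 1$, $0<|\lambda|<1$) and $p^k_\lambda(u)$ ($k\ge1$, $|\lambda|=1$, $u=\pm1$) of a simple structure are the multiplicities in an isomorphism of it with a finite direct sum $\bigoplus q^k_\lambda\cdot\mathcal V^{2k}_\lambda\oplus\bigoplus p^k_\lambda(u)\cdot\mathcal W^k_\lambda(u)$. Let $L\subset S^3$ be an oriented link and let $S$ be a Seifert matrix of $L$, that is, the matrix of the form $(\alpha,\beta)\mapsto \operatorname{lk}(\alpha,\beta^+)$ on $H_1(F;\mathbb Z)$, for a compact connected oriented surface $F$ bounded by $L$, where $\beta^+$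 is $\beta$ pushed off in the positive normal direction. Let $S_{\mathrm{ndeg}}$ be an invertible real matrix such that $S$ is S-equivalent over $\mathbb R$ to the block sum of a zero square matrix and $S_{\mathrm{ndeg}}$ (each possibly empty). The H-numbers of $L$ are those of the variation structure $\mathcal V_L=(b,h,V)$ with $V=(S_{\mathrm{ndeg}}^T)^{-1}$, $b=S_{\mathrm{ndeg}}-S_{\mathrm{ndeg}}^T$, $h=(S_{\mathrm{ndeg}}^T)^{-1}S_{\mathrm{ndeg}}$. For $\zeta\in S^1\setminus\{1\}$, the Tristram–Levine signature $\sigma(\zeta)$ of $L$ is the signature of the hermitian matrix $(1-\zeta)S+(1-\bar\zeta)S^T$. For $\alpha,\beta\in S^1$ write $\alpha<\beta$ if $\alpha=e^{2\pi i x}$, $\beta=e^{2\pi i y}$ with $x,y\in[0,1)$ and $x<y$. **Proposition.** For every $\zeta\in S^1\setminus\{1\}$, $$\sigma(\zeta)=\sigma(\bar\zeta)=-\sum_{\substack{\lambda<\zeta\\ k\text{ odd}\\ u=\pm1}}u\,p^k_\lambda(u)+\sum_{\substack{\lambda>\zeta\\ k\text{ odd}\\ u=\pm1}}u\,p^k_\lambda(u)+\sum_{\substack{k\text{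 even}\\ u=\pm1}}u\,p^k_\zeta(u).$$ -/

import Mathlib

open Matrix Filter Topology
open scoped ContDiff

noncomputable section

/-! ### Oriented links, Seifert surfaces and Seifert matrices

Links live in `S³ = ℝ³ ∪ {∞}` with its standard orientation.  A link in `S³`, and also any compact
surface bounded by it, misses a point of `S³`, which is taken to be `∞`. -/

/-- Euclidean three-space, with the orientation of the standard basis. -/
abbrev E3 : Type := EuclideanSpace ℝ (Fin 3)

/-- The determinant of the three vectors `x, y, z`. -/
def det3 (x y z : E3) : ℝ := Matrix.det !![x 0, x 1, x 2; y 0, y 1, y 2; z 0, z 1, z 2]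

/-- A (smooth, tame) oriented link: finitely many disjoint smoothly embedded oriented circles,
each of them parametrized by a `1`-periodic map of the line. -/
structure OrientedLink where
  numComponents : ℕ
  comp : Fin numComponents → ℝ → E3
  smooth : ∀ i, ContDiff ℝ ∞ (comp i)
  periodic : ∀ i, Function.Periodic (comp i) 1
  immersed : ∀ i t, deriv (comp i) t ≠ 0
  embedded : ∀ i j s t, comp i s = comp j t → i = j ∧ ∃ k : ℤ, s - t = k

/-- The set of points of the link. -/
def OrientedLink.support (L : OrientedLink) : Set E3 := {x | ∃ i t, L.comp i t = x}

/-- `Φ` is a local diffeomorphism of three-space near `x`. -/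
def IsDiffeoAt (Φ : OpenPartialHomeomorph E3 E3) (x : E3) : Prop :=
  x ∈ Φ.source ∧ ContDiffOn ℝ ∞ Φ Φ.source ∧ ContDiffOn ℝ ∞ Φ.symm Φ.target

/-- `Φ` flattens `F` near the point `x` to the plane `y₂ = 0`. -/
def IsInteriorChart (F : Set E3) (Φ : OpenPartialHomeomorph E3 E3) (x : E3) : Prop :=
  IsDiffeoAt Φ x ∧ ∀ y ∈ Φ.source, y ∈ F ↔ Φ y 2 = 0

/-- `Φ` flattens `F` near `x` to the half plane `y₂ = 0`, `y₀ ≥ 0`, and `x` is on the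
boundary. -/
def IsBoundaryChart (F : Set E3) (Φ : OpenPartialHomeomorph E3 E3) (x : E3) : Prop :=
  IsDiffeoAt Φ x ∧ (∀ y ∈ Φ.source, y ∈ F ↔ (Φ y 2 = 0 ∧ 0 ≤ Φ y 0)) ∧ Φ x 0 = 0 ∧ x ∈ F

/-- The vector `v` is orthogonal to the surface that `Φ` flattens to `y₂ = 0`. -/
def IsNormalAt (Φ : OpenPartialHomeomorph E3 E3) (x v : E3) : Prop :=
  ∀ w : E3, fderiv ℝ Φ x w 2 = 0 → inner ℝ v w = 0

/-- A Seifert surface of `L`: a compact connected smooth surface in three-space, oriented by a unit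
normal field `normal` (the positive direction), whose oriented boundary is `L`. -/
structure SeifertSurface (L : OrientedLink) where
  carrier : Set E3
  isCompact : IsCompact carrier
  isPathConnected : IsPathConnected carrier
  /-- only the values on the surface matter -/
  normal : E3 → E3
  normal_smooth : ContDiff ℝ ∞ normal
  normal_unit : ∀ x ∈ carrier, ‖normal x‖ = 1
  interior : ∀ x ∈ carrier, x ∉ L.support →
    ∃ Φ, IsInteriorChart carrier Φ x ∧ IsNormalAt Φ x (normal x)
  /-- Every point of the link is a boundary point, and there (outward vector tangent to the surface,
  direction of the link, positive normal) is a positive frame. -/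
  boundary : ∀ i t, ∃ Φ, IsBoundaryChart carrier Φ (L.comp i t) ∧
    IsNormalAt Φ (L.comp i t) (normal (L.comp i t)) ∧
    ∀ w : E3, fderiv ℝ Φ (L.comp i t) w 2 = 0 → fderiv ℝ Φ (L.comp i t) w 0 < 0 →
      0 < det3 w (deriv (L.comp i) t) (normal (L.comp i t))

/-- A smooth closed curve in `F`, based at `x` and parametrized `1`-periodically. -/
structure SmoothLoop (F : Set E3) (x : F) where
  toFun : ℝ → E3
  smooth : ContDiff ℝ ∞ toFun
  periodic : Function.Periodic toFun 1
  mem : ∀ t, toFun t ∈ F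
  base : toFun 0 = x

/-- The loop as a path of the space `F`. -/
def SmoothLoop.toPath {F : Set E3} {x : F} (γ : SmoothLoop F x) : Path x x where
  toFun t := ⟨γ.toFun t, γ.mem t⟩
  continuous_toFun := by
    have := γ.smooth.continuous
    fun_prop
  source' := Subtype.ext (by simpa using γ.base)
  target' := Subtype.ext (by
    have h := γ.periodic 0
    rw [zero_add, γ.base] at h
    simpa using h)

/-- The first integral homology group of a path connected space: its abelianized fundamental
group. -/
abbrev H1 (F : Set E3) (x : F) : Type := Additive (Abelianization (FundamentalGroup F x))

/-- The homology class of a loop. -/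
def SmoothLoop.homologyClass {F : Set E3} {x : F} (γ : SmoothLoop F x) : H1 F x :=
  Additive.ofMul (Abelianization.of (FundamentalGroup.fromPath (Path.Homotopic.Quotient.mk γ.toPath)))

/-- The linking number of two disjoint `1`-periodic closed curves, by Gauss's integral. -/
def linkingNumber (α β : ℝ → E3) : ℝ :=
  (1 / (4 * Real.pi)) * ∫ s in (0 : ℝ)..1, ∫ t in (0 : ℝ)..1,
    det3 (deriv α s) (deriv β t) (α s - β t) / ‖α s - β t‖ ^ 3

/-- `S` is a Seifert matrix of `L`: for some Seifert surface and some basis of its first homology,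
represented by closed curves `γ i`, the entry `S i j` is the linking number of `γ i` with
the curve obtained by pushing `γ j` a little in the positive direction. -/
def IsSeifertMatrix (L : OrientedLink) {m : ℕ} (S : Matrix (Fin m) (Fin m) ℤ) : Prop :=
  ∃ (F : SeifertSurface L) (x : F.carrier) (γ : Fin m → SmoothLoop F.carrier x)
    (e : Module.Basis (Fin m) ℤ (H1 F.carrier x)),
    (∀ i, e i = (γ i).homologyClass) ∧
    ∀ i j, ∀ᶠ δ in 𝓝[>] (0 : ℝ), (S i j : ℝ) =
      linkingNumber (γ i).toFun (fun t => (γ j).toFun t + δ • F.normal ((γ j).toFun t))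

/-! ### Real S-equivalence and the non-degenerate part of a Seifert matrix -/

/-- Real square matrices of all sizes. -/
abbrev RealSquareMatrix : Type := Σ m : ℕ, Matrix (Fin m) (Fin m) ℝ

/-- The elementary moves of S-equivalence over `ℝ`: congruences and the two elementary
enlargements. -/
inductive SMove : RealSquareMatrix → RealSquareMatrix → Prop
  | congr {m : ℕ} (S A : Matrix (Fin m) (Fin m) ℝ) (hA : IsUnit A) :
      SMove ⟨m, S⟩ ⟨m, A * S * Aᵀ⟩
  | enlargeCol {m : ℕ} (S : Matrix (Fin m) (Fin m) ℝ) (a : Fin m → ℝ) :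
      SMove ⟨m, S⟩ ⟨m + 2, Matrix.reindex finSumFinEquiv finSumFinEquiv
        (Matrix.fromBlocks S (Matrix.of fun i => ![a i, 0]) 0 !![0, 1; 0, 0])⟩
  | enlargeRow {m : ℕ} (S : Matrix (Fin m) (Fin m) ℝ) (a : Fin m → ℝ) :
      SMove ⟨m, S⟩ ⟨m + 2, Matrix.reindex finSumFinEquiv finSumFinEquiv
        (Matrix.fromBlocks S 0 (Matrix.of ![a, 0]) !![0, 0; 1, 0])⟩

/-- S-equivalence over `ℝ`: the equivalence relation generated by the moves. -/
def SEquivalent (S T : RealSquareMatrix) : Prop := Relation.EqvGen SMove S T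

/-- `N` is a non-degenerate part of `S`: it is invertible, and `S` is S-equivalent over `ℝ` to the
block sum of a zero square matrix and `N` (each of them may be empty). -/
def IsNondegeneratePart {m r : ℕ} (S : Matrix (Fin m) (Fin m) ℝ) (N : Matrix (Fin r) (Fin r) ℝ) :
    Prop :=
  IsUnit N ∧ ∃ d : ℕ, SEquivalent ⟨m, S⟩ ⟨d + r, Matrix.reindex finSumFinEquiv finSumFinEquiv
    (Matrix.fromBlocks (0 : Matrix (Fin d) (Fin d) ℝ) 0 0 N)⟩

/-! ### Hermitian variation structures -/

/-- An `ε`-hermitian variation structure `(U; b, h, V)` with `ε = (-1)^n` and `U = ℂ^ι`.  The maps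
`b : U → U*`, `h : U → U`, `V : U* → U` are given by their matrices in the standard basis and its
dual basis. -/
structure HVS (n : ℕ) (ι : Type) [Fintype ι] [DecidableEq ι] where
  b : Matrix ι ι ℂ
  h : Matrix ι ι ℂ
  V : Matrix ι ι ℂ
  b_hermitian : bᴴ = (-1 : ℂ) ^ n • b
  h_isUnit : IsUnit h
  h_orthogonal : hᴴ * b * h = b
  V_conjTranspose : Vᴴ = -((-1 : ℂ) ^ n • (V * hᴴ))
  V_mul_b : V * b = h - 1

namespace HVS

variable {n : ℕ} {ι κ : Type} [Fintype ι] [DecidableEq ι] [Fintype κ] [DecidableEq κ]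

/-- The structure is simple if its variation operator is an isomorphism. -/
def IsSimple (X : HVS n ι) : Prop := IsUnit X.V

/-- Isomorphism of variation structures; `φ : U → U'` is the isomorphism, `ψ` its inverse. -/
def IsIsomorphic (X : HVS n ι) (Y : HVS n κ) : Prop :=
  ∃ (φ : Matrix κ ι ℂ) (ψ : Matrix ι κ ℂ), ψ * φ = 1 ∧ φ * ψ = 1 ∧
    X.b = φᴴ * Y.b * φ ∧ X.h = ψ * Y.h * φ ∧ X.V = ψ * Y.V * ψᴴ

/-- The direct sum of two variation structures. -/
def directSum (X : HVS n ι) (Y : HVS n κ) : HVS n (ι ⊕ κ) where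
  b := Matrix.fromBlocks X.b 0 0 Y.b
  h := Matrix.fromBlocks X.h 0 0 Y.h
  V := Matrix.fromBlocks X.V 0 0 Y.V
  b_hermitian := by
    simp [Matrix.fromBlocks_conjTranspose, Matrix.fromBlocks_smul, X.b_hermitian, Y.b_hermitian]
  h_isUnit := by
    have hX := (Matrix.isUnit_iff_isUnit_det _).1 X.h_isUnit
    have hY := (Matrix.isUnit_iff_isUnit_det _).1 Y.h_isUnit
    rw [Matrix.isUnit_iff_isUnit_det, Matrix.det_fromBlocks_zero₂₁]
    exact hX.mul hY
  h_orthogonal := by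
    simp [Matrix.fromBlocks_conjTranspose, Matrix.fromBlocks_multiply, X.h_orthogonal,
      Y.h_orthogonal]
  V_conjTranspose := by
    simp [Matrix.fromBlocks_conjTranspose, Matrix.fromBlocks_multiply, Matrix.fromBlocks_smul,
      Matrix.fromBlocks_neg, X.V_conjTranspose, Y.V_conjTranspose]
  V_mul_b := by
    rw [← Matrix.fromBlocks_one, Matrix.fromBlocks_multiply, X.V_mul_b, Y.V_mul_b]
    ext (i | i) (j | j) <;> simp [Matrix.one_apply]

/-- The direct sum of a finite family of variation structures. -/
def iDirectSum {s : ℕ} {ι : Fin s → Type} [∀ i, Fintype (ι i)] [∀ i, DecidableEq (ι i)]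
    (X : ∀ i, HVS n (ι i)) : HVS n (Σ i, ι i) where
  b := Matrix.blockDiagonal' fun i => (X i).b
  h := Matrix.blockDiagonal' fun i => (X i).h
  V := Matrix.blockDiagonal' fun i => (X i).V
  b_hermitian := by
    rw [Matrix.blockDiagonal'_conjTranspose, ← Matrix.blockDiagonal'_smul]
    exact congrArg _ (funext fun i => (X i).b_hermitian)
  h_isUnit := by
    have hu : IsUnit (fun i => (X i).h) := Pi.isUnit_iff.2 fun i => (X i).h_isUnit
    exact hu.map (Matrix.blockDiagonal'RingHom ι ℂ)
  h_orthogonal := by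
    rw [Matrix.blockDiagonal'_conjTranspose, ← Matrix.blockDiagonal'_mul,
      ← Matrix.blockDiagonal'_mul]
    exact congrArg _ (funext fun i => (X i).h_orthogonal)
  V_conjTranspose := by
    rw [Matrix.blockDiagonal'_conjTranspose, Matrix.blockDiagonal'_conjTranspose,
      ← Matrix.blockDiagonal'_mul, ← Matrix.blockDiagonal'_smul, ← Matrix.blockDiagonal'_neg]
    exact congrArg _ (funext fun i => (X i).V_conjTranspose)
  V_mul_b := by
    rw [← Matrix.blockDiagonal'_mul, ← Matrix.blockDiagonal'_one, ← Matrix.blockDiagonal'_sub]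
    exact congrArg _ (funext fun i => (X i).V_mul_b)

end HVS

/-- The `k × k` (upper triangular) Jordan block with eigenvalue `1`. -/
def jordanOne (k : ℕ) : Matrix (Fin k) (Fin k) ℂ :=
  Matrix.of fun i j => if i = j ∨ (i : ℕ) + 1 = j then 1 else 0

/-- `b` is (a representative of) the non-degenerate `ε`-hermitian form `b^k_u`, `u = ±1`,
`ε = (-1)^n`, preserved by the Jordan block: its sign `u` is fixed by the corner entry
`b_{1,k} = u · i^{-n²-k+1}`.  Forms with these properties are unique up to an automorphism of `ℂ^k`
that commutes with the Jordan block. -/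
def IsBForm (n k : ℕ) (u : ℤˣ) (b : Matrix (Fin k) (Fin k) ℂ) : Prop :=
  bᴴ = (-1 : ℂ) ^ n • b ∧ IsUnit b ∧ (jordanOne k)ᴴ * b * jordanOne k = b ∧
    ∀ i j : Fin k, (i : ℕ) = 0 → (j : ℕ) + 1 = k →
      b i j = ((u : ℤ) : ℂ) * Complex.I ^ (-(n : ℤ) ^ 2 - (k : ℤ) + 1)

namespace HVS

variable {n k : ℕ}

/-- `X` is the structure `𝒱_μ^{2k}` (for `μ` not on the unit circle, `μ ≠ 0`). -/
def IsVBlock (X : HVS n (Fin k ⊕ Fin k)) (μ : ℂ) : Prop :=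
  X.b = Matrix.fromBlocks 0 1 ((-1 : ℂ) ^ n • 1) 0 ∧
  X.h = Matrix.fromBlocks (μ • jordanOne k) 0 0 ((star μ)⁻¹ • (jordanOne k)ᴴ⁻¹) ∧
  X.V = Matrix.fromBlocks 0 ((-1 : ℂ) ^ n • (μ • jordanOne k - 1))
    ((star μ)⁻¹ • (jordanOne k)ᴴ⁻¹ - 1) 0

/-- `X` is `𝒱_lam^k(u) = (ℂ^k; b^k_u, lam J_k, (lam J_k - I) (b^k_u)⁻¹)`. -/
def IsUnitaryBlock (X : HVS n (Fin k)) (lam : Circle) (u : ℤˣ) : Prop :=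
  IsBForm n k u X.b ∧ X.h = (lam : ℂ) • jordanOne k ∧
    X.V = ((lam : ℂ) • jordanOne k - 1) * X.b⁻¹

/-- `X` is the simple structure `𝒱̃_1^k(u)` with monodromy `J_k`: the form is `0 ⊕ b^{k-1}_u`
and `(V⁻¹)_{1,k} = u · i^{-n²-k}`.  (For `k = 1` this is `(ℂ; 0, I, u · i^{n²+1})`, for `k ≥ 2`
the last condition follows from the others.) -/
def IsUnipotentBlock (X : HVS n (Fin k)) (u : ℤˣ) : Prop :=
  X.h = jordanOne k ∧ X.IsSimple ∧
  (∀ i j : Fin k, (i : ℕ) = 0 ∨ (j : ℕ) = 0 → X.b i j = 0) ∧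
  IsBForm n (k - 1) u
    (X.b.submatrix (fun i : Fin (k - 1) => (⟨(i : ℕ) + 1, by omega⟩ : Fin k))
      (fun i : Fin (k - 1) => (⟨(i : ℕ) + 1, by omega⟩ : Fin k))) ∧
  ∀ i j : Fin k, (i : ℕ) = 0 → (j : ℕ) + 1 = k →
    X.V⁻¹ i j = ((u : ℤ) : ℂ) * Complex.I ^ (-(n : ℤ) ^ 2 - (k : ℤ))

/-- `X` is `𝒲_lam^k(u)`, the indecomposable simple structure with monodromy `lam J_k` and
sign `u`. -/
def IsWBlock (X : HVS n (Fin k)) (lam : Circle) (u : ℤˣ) : Prop :=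
  (lam ≠ 1 ∧ X.IsUnitaryBlock lam u) ∨ (lam = 1 ∧ X.IsUnipotentBlock u)

/-- `q` and `p` are the H-numbers of `X`: `X` is isomorphic to a direct sum of structures
`𝒱_μ^{2k}` (`0 < |μ| < 1`) and `𝒲_lam^k(u)` (`|lam| = 1`, `u = ±1`), in which `𝒱_μ^{2k}` occurs
`q k μ` times and `𝒲_lam^k(u)` occurs `p k lam u` times. -/
def IsHNumbers {ι : Type} [Fintype ι] [DecidableEq ι] (X : HVS n ι)
    (q : ℕ → ℂ → ℕ) (p : ℕ → Circle → ℤˣ → ℕ) : Prop :=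
  ∃ (s t : ℕ) (a : Fin s → ℕ) (μ : Fin s → ℂ)
    (c : Fin t → ℕ) (lam : Fin t → Circle) (u : Fin t → ℤˣ)
    (A : ∀ i, HVS n (Fin (a i) ⊕ Fin (a i))) (B : ∀ j, HVS n (Fin (c j))),
    (∀ i, 1 ≤ a i ∧ 0 < ‖μ i‖ ∧ ‖μ i‖ < 1 ∧ (A i).IsVBlock (μ i)) ∧
    (∀ j, 1 ≤ c j ∧ (B j).IsWBlock (lam j) (u j)) ∧
    X.IsIsomorphic ((iDirectSum A).directSum (iDirectSum B)) ∧
    (∀ k ν, q k ν = Nat.card {i : Fin s // a i = k ∧ μ i = ν}) ∧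
    (∀ k ν v, p k ν v = Nat.card {j : Fin t // c j = k ∧ lam j = ν ∧ u j = v})

/-- The variation structure with `ε = -1` of a link with non-degenerate part `N` of its
Seifert matrix: `V = (Nᵀ)⁻¹`, `b = N - Nᵀ`, `h = (Nᵀ)⁻¹ N`. -/
def ofSeifert {r : ℕ} (N : Matrix (Fin r) (Fin r) ℝ) (hN : IsUnit N) : HVS 1 (Fin r) where
  b := (N - Nᵀ).map Complex.ofRealHom
  h := (Nᵀ⁻¹ * N).map Complex.ofRealHom
  V := Nᵀ⁻¹.map Complex.ofRealHom
  b_hermitian := by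
    ext i j
    simp
  h_isUnit := by
    have ht : IsUnit Nᵀ⁻¹ := by rwa [Matrix.isUnit_nonsing_inv_iff, Matrix.isUnit_transpose]
    exact (ht.mul hN).map (RingHom.mapMatrix Complex.ofRealHom)
  h_orthogonal := by
    have hd := (Matrix.isUnit_iff_isUnit_det _).1 hN
    have hd' : IsUnit Nᵀ.det := by rwa [Matrix.det_transpose]
    have hc : ∀ M : Matrix (Fin r) (Fin r) ℝ,
        (M.map Complex.ofRealHom)ᴴ = Mᵀ.map Complex.ofRealHom := fun M => by ext i j; simp
    rw [hc, ← Matrix.map_mul, ← Matrix.map_mul]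
    congr 1
    rw [Matrix.transpose_mul, Matrix.transpose_nonsing_inv, Matrix.transpose_transpose,
      Matrix.mul_sub, Matrix.nonsing_inv_mul_cancel_right _ _ hd, Matrix.sub_mul,
      Matrix.mul_nonsing_inv_cancel_left _ _ hd']
    congr 1
    simp only [Matrix.mul_assoc]
    rw [Matrix.mul_nonsing_inv_cancel_left _ _ hd', Matrix.nonsing_inv_mul _ hd, Matrix.mul_one]
  V_conjTranspose := by
    have hd' : IsUnit Nᵀ.det := by
      rw [Matrix.det_transpose]; exact (Matrix.isUnit_iff_isUnit_det _).1 hN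
    have hc : ∀ M : Matrix (Fin r) (Fin r) ℝ,
        (M.map Complex.ofRealHom)ᴴ = Mᵀ.map Complex.ofRealHom := fun M => by ext i j; simp
    rw [hc, hc, ← Matrix.map_mul, pow_one, neg_smul, one_smul, neg_neg]
    congr 1
    rw [Matrix.transpose_mul, Matrix.transpose_nonsing_inv, Matrix.transpose_transpose,
      Matrix.nonsing_inv_mul_cancel_left _ _ hd']
  V_mul_b := by
    have hd' : IsUnit Nᵀ.det := by
      rw [Matrix.det_transpose]; exact (Matrix.isUnit_iff_isUnit_det _).1 hN
    rw [← Matrix.map_mul, Matrix.mul_sub, Matrix.nonsing_inv_mul _ hd']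
    exact (map_sub (RingHom.mapMatrix (m := Fin r) Complex.ofRealHom) _ _).trans
      (congrArg _ (map_one (RingHom.mapMatrix (m := Fin r) Complex.ofRealHom)))

end HVS

/-! ### Tristram–Levine signatures -/

/-- The signature of a hermitian matrix: the number of positive eigenvalues minus the number of
negative ones. -/
def hermitianSignature {ι : Type} [Fintype ι] [DecidableEq ι] (M : Matrix ι ι ℂ)
    (hM : M.IsHermitian) : ℤ :=
  (Nat.card {i // 0 < hM.eigenvalues i} : ℤ) - Nat.card {i // hM.eigenvalues i < 0}

/-- The form `M_S(ζ) = (1 - ζ) S + (1 - ζ̄) Sᵀ`. -/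
def seifertForm {m : ℕ} (S : Matrix (Fin m) (Fin m) ℤ) (ζ : Circle) : Matrix (Fin m) (Fin m) ℂ :=
  (1 - (ζ : ℂ)) • S.map (Int.cast : ℤ → ℂ) + (1 - star (ζ : ℂ)) • Sᵀ.map (Int.cast : ℤ → ℂ)

theorem seifertForm_isHermitian {m : ℕ} (S : Matrix (Fin m) (Fin m) ℤ) (ζ : Circle) :
    (seifertForm S ζ).IsHermitian := by
  ext i j
  simp [seifertForm, add_comm]

/-- The Tristram–Levine signature `σ(ζ)` computed from the Seifert matrix `S`. -/
def tristramLevine {m : ℕ} (S : Matrix (Fin m) (Fin m) ℤ) (ζ : Circle) : ℤ :=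
  hermitianSignature (seifertForm S ζ) (seifertForm_isHermitian S ζ)

/-- The order of the unit circle by the argument in `[0, 2π)`. -/
def CircleLT (α β : Circle) : Prop :=
  ∃ x ∈ Set.Ico (0 : ℝ) 1, ∃ y ∈ Set.Ico (0 : ℝ) 1,
    α = Circle.exp (2 * Real.pi * x) ∧ β = Circle.exp (2 * Real.pi * y) ∧ x < y

end

/-! The forms at `ζ` and `ζ⁻¹` are transposes of each other, so they have the same characteristic
polynomial and the same signature. The formula is therefore computed at `ζ⁻¹`, that is, for the
pencil `α S + ᾱ Sᵀ` with `α = 1 - ζ̄`.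

For `α ≠ 0` the signature of this pencil is invariant under S-equivalence, and a zero block adds
nothing, so `S` may be replaced by `N`. Since `N = Nᵀ V N` with `V = (Nᵀ)⁻¹`, the pencils of `N` and
`V` are congruent. An isomorphism of variation structures also acts on `V` by congruence, so the
signature is a sum over the indecomposable blocks.

A block `𝒱` has an off-diagonal `V` and contributes zero. For the others, a form preserved by a
Jordan block is anti-triangular with alternating entries on the antidiagonal
(`apply_eq_zero_of_jordan`, `apply_antidiag_of_jordan`). The signature of an anti-triangular
hermitian matrix can be read off its first nonzero antidiagonal: it is the sign of the entry that
this antidiagonal has on the diagonal, or zero if it has none. For `lam ≠ 1` the main antidiagonal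
is multiplied by `Im (α (1 - lam))`, whose sign tells whether `lam` precedes or follows `ζ`. This
gives `∓u` for odd `k`. At `lam = ζ` the main antidiagonal vanishes and the next one takes over,
which exchanges the parities. For `lam = 1` the same argument is applied to `V⁻¹`.

Signatures are handled through `HasInertia`. The largest semidefinite subspaces have dimensions `n₊
+ n₀` and `n₋ + n₀`, with sum `n + n₀`, so a pair whose dimensions reach this sum is optimal. Hence
only lower bounds on subspaces and an upper bound on the kernel are ever needed. -/

/-! ### Inertia of hermitian matrices -/

section Inertia

variable {ι κ : Type} [Fintype ι] [Fintype κ]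

/-- The real part of the value `x* M x` of the form with matrix `M`. -/
def formValue (M : Matrix ι ι ℂ) (x : ι → ℂ) : ℝ := (star x ⬝ᵥ M *ᵥ x).re

/-- `M` has signature `s`, witnessed by a positive and a negative semidefinite subspace whose
dimensions are as large as the nullity of `M` permits. -/
def HasInertia (M : Matrix ι ι ℂ) (s : ℤ) : Prop :=
  ∃ (P Q : Submodule ℂ (ι → ℂ)) (a b : ℕ), (∀ x ∈ P, 0 ≤ formValue M x) ∧
    (∀ x ∈ Q, formValue M x ≤ 0) ∧ a ≤ Module.finrank ℂ P ∧ b ≤ Module.finrank ℂ Q ∧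
    Fintype.card ι + Module.finrank ℂ (LinearMap.ker M.mulVecLin) ≤ a + b ∧ (a : ℤ) - b = s

theorem formValue_congr (M : Matrix κ κ ℂ) (φ : Matrix κ ι ℂ) (x : ι → ℂ) :
    formValue (φᴴ * M * φ) x = formValue M (φ *ᵥ x) := by
  unfold formValue
  rw [star_mulVec, ← dotProduct_mulVec, mulVec_mulVec, mulVec_mulVec, Matrix.mul_assoc]

theorem Submodule.finrank_le_of_injOn {V W : Type} [AddCommGroup V] [Module ℂ V]
    [AddCommGroup W] [Module ℂ W] [FiniteDimensional ℂ W] (P : Submodule ℂ V)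
    (Q : Submodule ℂ W) (f : V →ₗ[ℂ] W) (hf : ∀ x ∈ P, f x ∈ Q)
    (hi : ∀ x ∈ P, f x = 0 → x = 0) : Module.finrank ℂ P ≤ Module.finrank ℂ Q := by
  refine LinearMap.finrank_le_finrank_of_injective (f := f.restrict hf) ?_
  rw [injective_iff_map_eq_zero]
  rintro ⟨x, hx⟩ h
  exact Subtype.ext (hi x hx (congrArg Subtype.val h))

/-- Semidefinite subspaces are pulled back along `φ`, and `ψ` shows that no dimension is lost.
Having two mutually inverse matrices lets the index types differ. -/
theorem HasInertia.congr [DecidableEq ι] [DecidableEq κ] {M : Matrix ι ι ℂ} {M' : Matrix κ κ ℂ}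
    {s : ℤ} (φ : Matrix κ ι ℂ) (ψ : Matrix ι κ ℂ) (h₁ : ψ * φ = 1) (h₂ : φ * ψ = 1)
    (hM : M = φᴴ * M' * φ) (h : HasInertia M' s) : HasInertia M s := by
  obtain ⟨P, Q, a, b, hP, hQ, ha, hb, hab, hs⟩ := h
  have key : ∀ R : Submodule ℂ (κ → ℂ),
      Module.finrank ℂ R ≤ Module.finrank ℂ (R.comap φ.mulVecLin) := fun R =>
    Submodule.finrank_le_of_injOn _ _ ψ.mulVecLin (fun x hx => by simpa [h₂] using hx)
      (fun x _ h0 => by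
        have := congrArg (φ *ᵥ ·) h0
        simpa [h₂] using this)
  have hker : Module.finrank ℂ (LinearMap.ker M.mulVecLin) ≤
      Module.finrank ℂ (LinearMap.ker M'.mulVecLin) :=
    Submodule.finrank_le_of_injOn _ _ φ.mulVecLin (fun x hx => by
        have h3 : ψᴴ * φᴴ = 1 := by rw [← conjTranspose_mul, h₂, conjTranspose_one]
        have := congrArg (ψᴴ *ᵥ ·) (show M *ᵥ x = 0 from hx)
        simpa [hM, ← Matrix.mul_assoc, h3] using this)
      (fun x _ h0 => by
        have := congrArg (ψ *ᵥ ·) h0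
        simpa [h₁] using this)
  have hcard : Fintype.card ι = Fintype.card κ := by
    have e := Matrix.toLin'OfInv h₁ h₂
    simpa using e.finrank_eq
  exact ⟨P.comap φ.mulVecLin, Q.comap φ.mulVecLin, a, b,
    fun x hx => by rw [hM, formValue_congr]; exact hP _ hx,
    fun x hx => by rw [hM, formValue_congr]; exact hQ _ hx,
    ha.trans (key P), hb.trans (key Q), by omega, hs⟩

theorem HasInertia.neg {M : Matrix ι ι ℂ} {s : ℤ} (h : HasInertia M s) :
    HasInertia (-M) (-s) := by
  obtain ⟨P, Q, a, b, hP, hQ, ha, hb, hab, hs⟩ := h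
  have hf : ∀ x, formValue (-M) x = -formValue M x := fun x => by
    rw [formValue, neg_mulVec, dotProduct_neg, Complex.neg_re, formValue]
  have hk : LinearMap.ker (-M).mulVecLin = LinearMap.ker M.mulVecLin := by
    ext x; simp
  exact ⟨Q, P, b, a, fun x hx => by rw [hf]; linarith [hQ x hx],
    fun x hx => by rw [hf]; linarith [hP x hx], hb, ha, by rw [hk]; omega, by omega⟩

/-- The vectors supported on the indices that satisfy `p`. -/
def coordSubspace (p : ι → Prop) : Submodule ℂ (ι → ℂ) where
  carrier := {x | ∀ i, ¬ p i → x i = 0}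
  zero_mem' := by simp
  add_mem' := fun hx hy i hi => by simp [hx i hi, hy i hi]
  smul_mem' := fun c x hx i hi => by simp [hx i hi]

theorem card_le_finrank_coordSubspace (p : ι → Prop) :
    Nat.card {i // p i} ≤ Module.finrank ℂ (coordSubspace p) := by
  classical
  have h : Module.finrank ℂ (⊤ : Submodule ℂ ({i // p i} → ℂ)) ≤
      Module.finrank ℂ (coordSubspace p) := by
    refine Submodule.finrank_le_of_injOn _ _
      (Function.ExtendByZero.linearMap ℂ (Subtype.val : {i // p i} → ι)) (fun x _ i hi => ?_)
      (fun x _ h0 => ?_)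
    · refine Function.extend_apply' _ _ _ ?_
      rintro ⟨j, rfl⟩
      exact hi j.2
    · ext j
      have := congrFun h0 j
      rwa [Function.ExtendByZero.linearMap_apply, Subtype.val_injective.extend_apply] at this
  simpa using h

theorem finrank_le_card_of_le_coordSubspace (p : ι → Prop) (R : Submodule ℂ (ι → ℂ))
    (hR : R ≤ coordSubspace p) : Module.finrank ℂ R ≤ Nat.card {i // p i} := by
  classical
  have h : Module.finrank ℂ R ≤ Module.finrank ℂ (⊤ : Submodule ℂ ({i // p i} → ℂ)) := by
    refine Submodule.finrank_le_of_injOn _ _ (LinearMap.funLeft ℂ ℂ Subtype.val)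
      (fun _ _ => trivial) (fun x hx h0 => ?_)
    ext i
    by_cases hi : p i
    · exact congrFun h0 ⟨i, hi⟩
    · exact hR hx i hi
  simpa using h

theorem formValue_diagonal [DecidableEq ι] (d : ι → ℝ) (x : ι → ℂ) :
    formValue (diagonal fun i => (d i : ℂ)) x = ∑ i, d i * Complex.normSq (x i) := by
  simp only [formValue, dotProduct, mulVec_diagonal, Complex.re_sum]
  refine Finset.sum_congr rfl fun i _ => ?_
  simp [Complex.normSq_apply]
  ring

theorem ker_diagonal [DecidableEq ι] (d : ι → ℝ) :
    LinearMap.ker (diagonal fun i => (d i : ℂ)).mulVecLin = coordSubspace fun i => d i = 0 := by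
  ext x
  simp only [LinearMap.mem_ker, mulVecLin_apply, funext_iff, mulVec_diagonal, Pi.zero_apply,
    mul_eq_zero, Complex.ofReal_eq_zero]
  exact forall_congr' fun i => by tauto

theorem card_signs (d : ι → ℝ) : Nat.card {i // 0 < d i} + Nat.card {i // d i < 0} +
      Nat.card {i // d i = 0} = Fintype.card ι ∧
    Nat.card {i // 0 ≤ d i} = Nat.card {i // 0 < d i} + Nat.card {i // d i = 0} ∧
    Nat.card {i // d i ≤ 0} = Nat.card {i // d i < 0} + Nat.card {i // d i = 0} := by
  have hι : Fintype.card ι = ∑ _i : ι, 1 := by simp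
  simp only [Nat.card_eq_fintype_card, Fintype.card_subtype, Finset.card_filter,
    ← Finset.sum_add_distrib, hι]
  refine ⟨?_, ?_, ?_⟩ <;> refine Finset.sum_congr rfl fun i _ => ?_ <;>
    rcases lt_trichotomy (d i) 0 with h | h | h <;>
    grind

/-- A subspace on which the form is nonnegative meets the span of the negative coordinates, where
the form is negative definite, only in zero. -/
theorem finrank_add_card_neg_le (d : ι → ℝ) (P : Submodule ℂ (ι → ℂ))
    (hP : ∀ x ∈ P, 0 ≤ ∑ i, d i * Complex.normSq (x i)) :
    Module.finrank ℂ P + Nat.card {i // d i < 0} ≤ Fintype.card ι := by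
  have hd : Disjoint P (coordSubspace fun i => d i < 0) := by
    rw [Submodule.disjoint_def]
    intro x hx hx'
    have hle : ∀ i ∈ Finset.univ, d i * Complex.normSq (x i) ≤ 0 := fun i _ => by
      by_cases hi : d i < 0
      · exact mul_nonpos_of_nonpos_of_nonneg hi.le (Complex.normSq_nonneg _)
      · simp [hx' i hi]
    have h0 := (Finset.sum_eq_zero_iff_of_nonpos hle).1
      (le_antisymm (Finset.sum_nonpos hle) (hP x hx))
    ext i
    by_cases hi : d i < 0
    · simpa [hi.ne] using h0 i (Finset.mem_univ i)
    · exact hx' i hi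
  have h1 := Submodule.finrank_add_finrank_le_of_disjoint hd
  have h2 := card_le_finrank_coordSubspace fun i => d i < 0
  rw [Module.finrank_fintype_fun_eq_card] at h1
  omega

variable [DecidableEq ι]

theorem HasInertia.of_diagonal (d : ι → ℝ) : HasInertia (diagonal fun i => (d i : ℂ))
    ((Nat.card {i // 0 < d i} : ℤ) - Nat.card {i // d i < 0}) := by
  obtain ⟨h1, h2, h3⟩ := card_signs d
  refine ⟨coordSubspace fun i => 0 ≤ d i, coordSubspace fun i => d i ≤ 0, _, _, fun x hx => ?_,
    fun x hx => ?_, card_le_finrank_coordSubspace _, card_le_finrank_coordSubspace _, ?_, ?_⟩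
  · rw [formValue_diagonal]
    refine Finset.sum_nonneg fun i _ => ?_
    by_cases hi : 0 ≤ d i
    · exact mul_nonneg hi (Complex.normSq_nonneg _)
    · simp [hx i hi]
  · rw [formValue_diagonal]
    refine Finset.sum_nonpos fun i _ => ?_
    by_cases hi : d i ≤ 0
    · exact mul_nonpos_of_nonpos_of_nonneg hi (Complex.normSq_nonneg _)
    · simp [hx i hi]
  · have := finrank_le_card_of_le_coordSubspace (fun i => d i = 0) _ (ker_diagonal d).le
    omega
  · push_cast [h2, h3]
    ring

/-- The bounds `a ≤ n - n₋` and `b ≤ n - n₊` add up to `n + n₀`, which is at most `a + b` by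
hypothesis. Both are therefore equalities. -/
theorem HasInertia.eq_of_diagonal {d : ι → ℝ} {s : ℤ}
    (h : HasInertia (diagonal fun i => (d i : ℂ)) s) :
    s = (Nat.card {i // 0 < d i} : ℤ) - Nat.card {i // d i < 0} := by
  obtain ⟨P, Q, a, b, hP, hQ, ha, hb, hab, rfl⟩ := h
  simp only [formValue_diagonal] at hP hQ
  have h1 := finrank_add_card_neg_le d P hP
  have h2 := finrank_add_card_neg_le (fun i => -d i) Q fun x hx => by
    simpa using hQ x hx
  simp only [neg_lt_zero] at h2
  have h3 := card_le_finrank_coordSubspace fun i => d i = 0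
  rw [← ker_diagonal d] at h3
  have h4 := (card_signs d).1
  omega

theorem exists_unitary_diagonal {M : Matrix ι ι ℂ} (hM : M.IsHermitian) :
    ∃ U : Matrix ι ι ℂ, Uᴴ * U = 1 ∧ U * Uᴴ = 1 ∧
      M = U * (diagonal fun i => (hM.eigenvalues i : ℂ)) * Uᴴ := by
  refine ⟨hM.eigenvectorUnitary, Unitary.coe_star_mul_self _, Unitary.coe_mul_star_self _, ?_⟩
  have h := hM.spectral_theorem
  rw [Unitary.conjStarAlgAut_apply] at h
  exact h

theorem hasInertia_hermitianSignature {M : Matrix ι ι ℂ} (hM : M.IsHermitian) :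
    HasInertia M (hermitianSignature M hM) := by
  obtain ⟨U, h1, h2, h3⟩ := exists_unitary_diagonal hM
  exact (HasInertia.of_diagonal hM.eigenvalues).congr Uᴴ U h2 h1 (by simpa using h3)

/-- Sylvester's law of inertia. -/
theorem HasInertia.signature_eq {M : Matrix ι ι ℂ} {s : ℤ} (h : HasInertia M s)
    (hM : M.IsHermitian) : hermitianSignature M hM = s := by
  obtain ⟨U, h1, h2, h3⟩ := exists_unitary_diagonal hM
  refine (HasInertia.eq_of_diagonal (h.congr U Uᴴ h1 h2 ?_)).symm
  conv_rhs => rw [h3]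
  simp only [Matrix.mul_assoc]
  rw [h1, Matrix.mul_one, ← Matrix.mul_assoc, h1, Matrix.one_mul]

theorem HasInertia.unique {M : Matrix ι ι ℂ} {s t : ℤ} (hM : M.IsHermitian) (h : HasInertia M s)
    (h' : HasInertia M t) : s = t :=
  (h.signature_eq hM).symm.trans (h'.signature_eq hM)

theorem hermitianSignature_transpose {M : Matrix ι ι ℂ} (hM : M.IsHermitian)
    (hM' : Mᵀ.IsHermitian) : hermitianSignature Mᵀ hM' = hermitianSignature M hM := by
  have h : hM'.eigenvalues = hM.eigenvalues :=
    (Matrix.IsHermitian.eigenvalues_eq_eigenvalues_iff hM' hM).2 (Matrix.charpoly_transpose M)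
  simp only [hermitianSignature, h]

end Inertia

/-! ### Signatures of block sums, enlargements and off-diagonal block matrices -/

section BlockSums

variable {ι κ : Type} [Fintype ι] [Fintype κ]

theorem formValue_fromBlocks_diag (A : Matrix ι ι ℂ) (B : Matrix κ κ ℂ) (x : ι ⊕ κ → ℂ) :
    formValue (fromBlocks A 0 0 B) x =
      formValue A (x ∘ Sum.inl) + formValue B (x ∘ Sum.inr) := by
  simp [formValue, fromBlocks_mulVec, dotProduct]

theorem HasInertia.zero : HasInertia (0 : Matrix ι ι ℂ) 0 := by
  refine ⟨⊤, ⊤, _, _, fun x _ => ?_, fun x _ => ?_, le_rfl, le_rfl, ?_, sub_self _⟩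
  · simp [formValue]
  · simp [formValue]
  · have h := Submodule.finrank_le (LinearMap.ker (0 : Matrix ι ι ℂ).mulVecLin)
    rw [finrank_top]
    rw [Module.finrank_fintype_fun_eq_card] at *
    omega

theorem HasInertia.fromBlocks {A : Matrix ι ι ℂ} {B : Matrix κ κ ℂ} {s t : ℤ}
    (hA : HasInertia A s) (hB : HasInertia B t) :
    HasInertia (fromBlocks A 0 0 B) (s + t) := by
  obtain ⟨P, Q, a, b, hP, hQ, ha, hb, hab, rfl⟩ := hA
  obtain ⟨P', Q', a', b', hP', hQ', ha', hb', hab', rfl⟩ := hB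
  let e := LinearEquiv.sumArrowLequivProdArrow ι κ ℂ ℂ
  let F (X : Submodule ℂ (ι → ℂ)) (Y : Submodule ℂ (κ → ℂ)) : Submodule ℂ (ι ⊕ κ → ℂ) :=
    (X.prod Y).comap e.toLinearMap
  have hF : ∀ (X : Submodule ℂ (ι → ℂ)) (Y : Submodule ℂ (κ → ℂ)), Module.finrank ℂ X + Module.finrank ℂ Y ≤ Module.finrank ℂ (F X Y) := by
    intro X Y
    rw [← Module.finrank_prod]
    let f : (X × Y) →ₗ[ℂ] F X Y :=
      (e.symm.toLinearMap ∘ₗ X.subtype.prodMap Y.subtype).codRestrict (F X Y)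
        (fun z => ⟨z.1.2, z.2.2⟩)
    refine LinearMap.finrank_le_finrank_of_injective (f := f) fun z w h => ?_
    have h' := e.symm.injective (congrArg Subtype.val h)
    exact Prod.ext (Subtype.ext (congrArg Prod.fst h')) (Subtype.ext (congrArg Prod.snd h'))
  have hmem : ∀ (X Y) (x : ι ⊕ κ → ℂ), x ∈ F X Y → x ∘ Sum.inl ∈ X ∧ x ∘ Sum.inr ∈ Y :=
    fun X Y x hx => hx
  have hker : Module.finrank ℂ (LinearMap.ker (Matrix.fromBlocks A 0 0 B).mulVecLin) ≤
      Module.finrank ℂ (LinearMap.ker A.mulVecLin) +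
        Module.finrank ℂ (LinearMap.ker B.mulVecLin) := by
    rw [← Module.finrank_prod]
    have hk : ∀ x ∈ LinearMap.ker (Matrix.fromBlocks A 0 0 B).mulVecLin,
        A *ᵥ (x ∘ Sum.inl) = 0 ∧ B *ᵥ (x ∘ Sum.inr) = 0 := by
      intro x hx
      have hx' : Matrix.fromBlocks A 0 0 B *ᵥ x = 0 := hx
      rw [fromBlocks_mulVec] at hx'
      constructor
      · ext i; simpa using congrFun hx' (Sum.inl i)
      · ext i; simpa using congrFun hx' (Sum.inr i)
    let f := (((LinearMap.funLeft ℂ ℂ (Sum.inl : ι → ι ⊕ κ)).domRestrict _).codRestrict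
      (LinearMap.ker A.mulVecLin) fun x => (hk x.1 x.2).1).prod
      (((LinearMap.funLeft ℂ ℂ (Sum.inr : κ → ι ⊕ κ)).domRestrict _).codRestrict
      (LinearMap.ker B.mulVecLin) fun x => (hk x.1 x.2).2)
    refine LinearMap.finrank_le_finrank_of_injective (f := f) fun z w h => ?_
    refine Subtype.ext (e.injective (Prod.ext ?_ ?_))
    · exact congrArg (fun y => y.1.1) h
    · exact congrArg (fun y => y.2.1) h
  refine ⟨F P P', F Q Q', a + a', b + b', fun x hx => ?_, fun x hx => ?_,
    (add_le_add ha ha').trans (hF _ _), (add_le_add hb hb').trans (hF _ _), ?_, ?_⟩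
  · rw [formValue_fromBlocks_diag]
    exact add_nonneg (hP _ (hmem _ _ x hx).1) (hP' _ (hmem _ _ x hx).2)
  · rw [formValue_fromBlocks_diag]
    exact add_nonpos (hQ _ (hmem _ _ x hx).1) (hQ' _ (hmem _ _ x hx).2)
  · rw [Fintype.card_sum]
    omega
  · push_cast
    ring

theorem blockDiagonal'_mulVec_apply {T : Type} [Fintype T] [DecidableEq T] {ν : T → Type}
    [∀ i, Fintype (ν i)] (M : ∀ i, Matrix (ν i) (ν i) ℂ) (x : (Σ i, ν i) → ℂ) (i : T) (j : ν i) :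
    (blockDiagonal' M *ᵥ x) ⟨i, j⟩ = (M i *ᵥ fun k => x ⟨i, k⟩) j := by
  rw [mulVec, dotProduct, Fintype.sum_sigma, Finset.sum_eq_single i]
  · simp [mulVec, dotProduct]
  · intro k _ hk
    simp [blockDiagonal'_apply_ne M _ _ hk.symm]
  · simp

/-- Products of semidefinite subspaces are semidefinite, and a kernel vector of the sum has all its
components in the kernels of the summands. -/
theorem HasInertia.blockDiagonal' {T : Type} [Fintype T] [DecidableEq T] {ν : T → Type}
    [∀ i, Fintype (ν i)] {M : ∀ i, Matrix (ν i) (ν i) ℂ} {s : T → ℤ}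
    (h : ∀ i, HasInertia (M i) (s i)) : HasInertia (blockDiagonal' M) (∑ i, s i) := by
  choose P Q a b hP hQ ha hb hab hs using h
  let F (X : ∀ i, Submodule ℂ (ν i → ℂ)) : Submodule ℂ ((Σ i, ν i) → ℂ) :=
    ⨅ i, (X i).comap (LinearMap.funLeft ℂ ℂ (Sigma.mk i))
  have hmem : ∀ X x, x ∈ F X ↔ ∀ i, (fun k => x ⟨i, k⟩) ∈ X i := fun X x => by
    simp [F, LinearMap.funLeft, Function.comp_def]
  have hF : ∀ X, ∑ i, Module.finrank ℂ (X i) ≤ Module.finrank ℂ (F X) := by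
    intro X
    rw [← Module.finrank_pi_fintype]
    let g : (∀ i, X i) →ₗ[ℂ] ((Σ i, ν i) → ℂ) :=
      { toFun := fun z k => (z k.1).1 k.2
        map_add' := fun _ _ => rfl
        map_smul' := fun _ _ => rfl }
    let f := g.codRestrict (F X) (fun z => (hmem _ _).2 fun i => (z i).2)
    refine LinearMap.finrank_le_finrank_of_injective (f := f) fun z w h => ?_
    have h' : g z = g w := congrArg Subtype.val h
    funext i
    refine Subtype.ext (funext fun k => congrFun h' ⟨i, k⟩)
  have hker : Module.finrank ℂ (LinearMap.ker (Matrix.blockDiagonal' M).mulVecLin) ≤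
      ∑ i, Module.finrank ℂ (LinearMap.ker (M i).mulVecLin) := by
    rw [← Module.finrank_pi_fintype]
    have hk : ∀ x ∈ LinearMap.ker (Matrix.blockDiagonal' M).mulVecLin, ∀ i,
        LinearMap.funLeft ℂ ℂ (Sigma.mk i) x ∈ LinearMap.ker (M i).mulVecLin := by
      intro x hx i
      refine funext fun j => ?_
      exact (blockDiagonal'_mulVec_apply M x i j).symm.trans
        (congrFun (show Matrix.blockDiagonal' M *ᵥ x = 0 from hx) ⟨i, j⟩)
    let f := LinearMap.pi fun i => ((LinearMap.funLeft ℂ ℂ (Sigma.mk (β := ν) i)).domRestrict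
      (LinearMap.ker (Matrix.blockDiagonal' M).mulVecLin)).codRestrict
        (LinearMap.ker (M i).mulVecLin) fun x => hk x.1 x.2 i
    refine LinearMap.finrank_le_finrank_of_injective (f := f) fun z w h => ?_
    refine Subtype.ext (funext fun k => ?_)
    exact congrFun (congrArg Subtype.val (congrFun h k.1)) k.2
  have hval : ∀ x, formValue (Matrix.blockDiagonal' M) x =
      ∑ i, formValue (M i) fun k => x ⟨i, k⟩ := fun x => by
    simp only [formValue, dotProduct, Fintype.sum_sigma, blockDiagonal'_mulVec_apply,
      Complex.re_sum]
    rfl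
  refine ⟨F P, F Q, ∑ i, a i, ∑ i, b i, fun x hx => ?_, fun x hx => ?_,
    (Finset.sum_le_sum fun i _ => ha i).trans (hF _),
    (Finset.sum_le_sum fun i _ => hb i).trans (hF _), ?_, ?_⟩
  · rw [hval]
    exact Finset.sum_nonneg fun i _ => hP i _ ((hmem _ _).1 hx i)
  · rw [hval]
    exact Finset.sum_nonpos fun i _ => hQ i _ ((hmem _ _).1 hx i)
  · have := Finset.sum_le_sum fun i (_ : i ∈ Finset.univ) => hab i
    simp only [Finset.sum_add_distrib] at this
    rw [Fintype.card_sigma]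
    omega
  · simp [← hs, Finset.sum_sub_distrib]

/-- Adding a pair of rows and columns in which the last basis vector is isotropic and pairs
nontrivially only with its partner does not change the signature. -/
theorem HasInertia.enlarge {M : Matrix ι ι ℂ} {s : ℤ} (hM : HasInertia M s)
    (B : Matrix ι (Fin 2) ℂ) (C : Matrix (Fin 2) ι ℂ) (D : Matrix (Fin 2) (Fin 2) ℂ)
    (hB : ∀ i, B i 1 = 0) (hC : ∀ i, C 1 i = 0) (hD₁₁ : D 1 1 = 0) (hD₁₀ : D 1 0 ≠ 0)
    (hD₀₁ : D 0 1 ≠ 0) : HasInertia (Matrix.fromBlocks M B C D) s := by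
  obtain ⟨P, Q, a, b, hP, hQ, ha, hb, hab, hs⟩ := hM
  -- On the hyperplane where the first new coordinate vanishes the form only sees `M`, and the
  -- second new coordinate is free. Both witnesses thus gain one dimension.
  let F (X : Submodule ℂ (ι → ℂ)) : Submodule ℂ (ι ⊕ Fin 2 → ℂ) :=
    X.comap (LinearMap.funLeft ℂ ℂ Sum.inl) ⊓ LinearMap.ker (LinearMap.proj (Sum.inr 0))
  have hmem : ∀ X x, x ∈ F X ↔ x ∘ Sum.inl ∈ X ∧ x (Sum.inr 0) = 0 := fun X x => Iff.rfl
  have hF : ∀ X : Submodule ℂ (ι → ℂ), Module.finrank ℂ X + 1 ≤ Module.finrank ℂ (F X) := by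
    intro X
    have h1 : Module.finrank ℂ (X × ℂ) = Module.finrank ℂ X + 1 := by
      rw [Module.finrank_prod, Module.finrank_self]
    rw [← h1]
    let g : (X × ℂ) →ₗ[ℂ] (ι ⊕ Fin 2 → ℂ) :=
      { toFun := fun z => Sum.elim z.1.1 ![0, z.2]
        map_add' := fun z w => by ext (i | i) <;> [skip; fin_cases i] <;> simp
        map_smul' := fun z w => by ext (i | i) <;> [skip; fin_cases i] <;> simp }
    let f := g.codRestrict (F X) (fun z => (hmem _ _).2 ⟨z.1.2, rfl⟩)
    refine LinearMap.finrank_le_finrank_of_injective (f := f) fun z w h => ?_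
    have h' : g z = g w := congrArg Subtype.val h
    exact Prod.ext (Subtype.ext (funext fun i => congrFun h' (Sum.inl i)))
      (congrFun h' (Sum.inr 1))
  have hCx : ∀ y : ι → ℂ, (C *ᵥ y) 1 = 0 := fun y => by simp [mulVec, dotProduct, hC]
  have hDx : ∀ (y : Fin 2 → ℂ) i, (D *ᵥ y) i = D i 0 * y 0 + D i 1 * y 1 := fun y i => by
    simp [mulVec, dotProduct]
  have hval : ∀ x : ι ⊕ Fin 2 → ℂ, x (Sum.inr 0) = 0 →
      formValue (Matrix.fromBlocks M B C D) x = formValue M (x ∘ Sum.inl) := by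
    intro x hx
    have hBx : B *ᵥ (x ∘ Sum.inr) = 0 := by
      ext i
      simp [mulVec, dotProduct, hx, hB]
    rw [formValue, fromBlocks_mulVec, hBx, add_zero, dotProduct, Fintype.sum_sum_type]
    simp only [Fin.sum_univ_two, Sum.elim_inl, Sum.elim_inr, Pi.add_apply, Pi.star_apply, hCx, hDx,
      hx, hD₁₁, Function.comp_apply]
    simp [formValue, dotProduct]
  have hker : Module.finrank ℂ (LinearMap.ker (Matrix.fromBlocks M B C D).mulVecLin) ≤
      Module.finrank ℂ (LinearMap.ker M.mulVecLin) := by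
    have hk : ∀ x ∈ LinearMap.ker (Matrix.fromBlocks M B C D).mulVecLin,
        x (Sum.inr 0) = 0 ∧ M *ᵥ (x ∘ Sum.inl) = 0 ∧
          (C *ᵥ (x ∘ Sum.inl)) 0 + D 0 1 * x (Sum.inr 1) = 0 := by
      intro x hx
      have hx' : Matrix.fromBlocks M B C D *ᵥ x = 0 := hx
      rw [fromBlocks_mulVec] at hx'
      -- The last row of the matrix is zero except for `D 1 0`. The row before it then determines
      -- the last coordinate from the old ones, so the kernel does not grow.
      have h0 : x (Sum.inr 0) = 0 := by
        have := congrFun hx' (Sum.inr 1)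
        simp only [Sum.elim_inr, Pi.add_apply, hCx, hDx, hD₁₁] at this
        simpa [hD₁₀] using this
      refine ⟨h0, ?_, ?_⟩
      · ext i
        have := congrFun hx' (Sum.inl i)
        simpa [mulVec, dotProduct, hB, h0] using this
      · have := congrFun hx' (Sum.inr 0)
        simp only [Sum.elim_inr, Pi.add_apply, hDx, Function.comp_apply, h0] at this
        simpa using this
    refine Submodule.finrank_le_of_injOn _ _ (LinearMap.funLeft ℂ ℂ Sum.inl)
      (fun x hx => (hk x hx).2.1) (fun x hx h0 => ?_)
    obtain ⟨h1, -, h3⟩ := hk x hx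
    have h0' : x ∘ Sum.inl = 0 := h0
    rw [h0', mulVec_zero, Pi.zero_apply, zero_add, mul_eq_zero, or_iff_right hD₀₁] at h3
    ext (i | i)
    · exact congrFun h0' i
    · fin_cases i
      exacts [h1, h3]
  refine ⟨F P, F Q, a + 1, b + 1, fun x hx => ?_, fun x hx => ?_,
    (Nat.add_le_add_right ha 1).trans (hF _), (Nat.add_le_add_right hb 1).trans (hF _), ?_, ?_⟩
  · rw [hval x hx.2]
    exact hP _ hx.1
  · rw [hval x hx.2]
    exact hQ _ hx.1
  · rw [Fintype.card_sum, Fintype.card_fin]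
    omega
  · push_cast
    linarith

theorem HasInertia.reindex [DecidableEq ι] [DecidableEq κ] {M : Matrix ι ι ℂ} {s : ℤ}
    (hM : HasInertia M s) (e : ι ≃ κ) : HasInertia (Matrix.reindex e e M) s := by
  refine hM.congr ((1 : Matrix ι ι ℂ).submatrix id e.symm) ((1 : Matrix ι ι ℂ).submatrix e.symm id)
    ?_ ?_ ?_
  · ext i j
    simp [Matrix.mul_apply, Matrix.one_apply]
  · ext i j
    simp only [Matrix.mul_apply, submatrix_apply, Matrix.one_apply, id]
    rw [e.symm.sum_comp fun k => (if i = k then (1 : ℂ) else 0) * if k = j then 1 else 0]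
    simp
  · ext i j
    simp [conjTranspose_submatrix, Matrix.mul_apply, Matrix.one_apply]

/-- A matrix of block form `(0 X; Xᴴ 0)` has signature zero. -/
theorem hasInertia_fromBlocks_antidiag [DecidableEq ι] [DecidableEq κ] (X : Matrix ι κ ℂ) :
    HasInertia (Matrix.fromBlocks 0 X Xᴴ 0) 0 := by
  have hM : (Matrix.fromBlocks 0 X Xᴴ 0).IsHermitian := by
    simp [IsHermitian, fromBlocks_conjTranspose]
  have h := hasInertia_hermitianSignature hM
  -- Congruence by `diag(1, -1)` turns the matrix into its negative, so its signature equals its own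
  -- opposite.
  have hD : Matrix.fromBlocks (1 : Matrix ι ι ℂ) 0 0 (-1 : Matrix κ κ ℂ) *
      Matrix.fromBlocks 1 0 0 (-1) = 1 := by
    simp [fromBlocks_multiply]
  have h' := h.neg.congr (Matrix.fromBlocks 1 0 0 (-1)) (Matrix.fromBlocks 1 0 0 (-1)) hD hD
    (M := Matrix.fromBlocks 0 X Xᴴ 0) (by
      simp [fromBlocks_multiply, fromBlocks_conjTranspose, fromBlocks_neg])
  have h0 := h.unique hM h'
  rwa [show hermitianSignature _ hM = 0 by omega] at h

end BlockSums

/-! ### Signatures of hermitian pencils and S-equivalence -/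

section Pencil

variable {ι κ : Type} [Fintype ι] [DecidableEq ι] [Fintype κ] [DecidableEq κ]

/-- The hermitian matrix `α M + ᾱ M*`. -/
def pencil {ι : Type} (α : ℂ) (M : Matrix ι ι ℂ) : Matrix ι ι ℂ := α • M + star α • Mᴴ

omit [Fintype ι] [DecidableEq ι] in
theorem pencil_isHermitian (α : ℂ) (M : Matrix ι ι ℂ) : (pencil α M).IsHermitian := by
  ext i j
  simp [pencil, add_comm]

omit [DecidableEq ι] [DecidableEq κ] [Fintype ι] in
theorem pencil_congr (α : ℂ) (M : Matrix κ κ ℂ) (φ : Matrix κ ι ℂ) :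
    pencil α (φᴴ * M * φ) = φᴴ * pencil α M * φ := by
  simp [pencil, Matrix.mul_add, Matrix.add_mul, Matrix.mul_assoc]

theorem HasInertia.pencil_congr {α : ℂ} {M : Matrix ι ι ℂ} {M' : Matrix κ κ ℂ} {s : ℤ}
    (h : HasInertia (pencil α M') s) (φ : Matrix κ ι ℂ) (ψ : Matrix ι κ ℂ) (h₁ : ψ * φ = 1)
    (h₂ : φ * ψ = 1) (hM : M = φᴴ * M' * φ) : HasInertia (pencil α M) s :=
  h.congr φ ψ h₁ h₂ (by rw [hM, _root_.pencil_congr])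

omit [DecidableEq ι] [Fintype ι] [Fintype κ] [DecidableEq κ] in
theorem pencil_fromBlocks (α : ℂ) (A : Matrix ι ι ℂ) (B : Matrix ι κ ℂ) (C : Matrix κ ι ℂ)
    (D : Matrix κ κ ℂ) : pencil α (fromBlocks A B C D) =
      fromBlocks (pencil α A) (α • B + star α • Cᴴ) (α • C + star α • Bᴴ) (pencil α D) := by
  simp [pencil, fromBlocks_conjTranspose, fromBlocks_smul, fromBlocks_add]

theorem pencil_blockDiagonal' (α : ℂ) {T : Type} [DecidableEq T] {ν : T → Type}
    (M : ∀ i, Matrix (ν i) (ν i) ℂ) :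
    pencil α (blockDiagonal' M) = blockDiagonal' fun i => pencil α (M i) := by
  rw [pencil, blockDiagonal'_conjTranspose, ← blockDiagonal'_smul, ← blockDiagonal'_smul,
    ← blockDiagonal'_add]
  rfl

omit [Fintype ι] [DecidableEq ι] [Fintype κ] [DecidableEq κ] in
theorem pencil_reindex (α : ℂ) (M : Matrix ι ι ℂ) (e : ι ≃ κ) :
    pencil α (reindex e e M) = reindex e e (pencil α M) := rfl

/-- The hermitian pencil of a real matrix. -/
def realPencil {ι : Type} (α : ℂ) (S : Matrix ι ι ℝ) : Matrix ι ι ℂ :=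
  pencil α (S.map Complex.ofRealHom)

/-- In the pencil of an enlargement the corner block becomes off-diagonal with entries `α` and `ᾱ`,
up to order. These are nonzero, as `HasInertia.enlarge` requires. -/
theorem HasInertia.of_sMove {α : ℂ} (hα : α ≠ 0) {S T : RealSquareMatrix} (h : SMove S T) {s : ℤ}
    (hs : HasInertia (realPencil α S.2) s) : HasInertia (realPencil α T.2) s := by
  have hα' : star α ≠ 0 := star_ne_zero.2 hα
  cases h with
  | @congr m S A hA =>
    have hA' : IsUnit A.det := (Matrix.isUnit_iff_isUnit_det _).1 hA
    have hmul : ∀ M N : Matrix (Fin m) (Fin m) ℝ, M.map Complex.ofRealHom * N.map Complex.ofRealHom =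
        (M * N).map Complex.ofRealHom := fun M N => (Matrix.map_mul).symm
    have hone : (1 : Matrix (Fin m) (Fin m) ℝ).map Complex.ofRealHom = 1 :=
      Matrix.map_one _ (map_zero _) (map_one _)
    refine HasInertia.pencil_congr hs (Aᵀ.map Complex.ofRealHom) (A⁻¹ᵀ.map Complex.ofRealHom)
      ?_ ?_ ?_
    · rw [hmul, ← transpose_mul, mul_nonsing_inv _ hA', transpose_one, hone]
    · rw [hmul, ← transpose_mul, nonsing_inv_mul _ hA', transpose_one, hone]
    · have hc : (Aᵀ.map Complex.ofRealHom)ᴴ = A.map Complex.ofRealHom := by ext i j; simp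
      rw [hc, hmul, hmul]
  | enlargeCol S a =>
    simp only [realPencil, reindex_apply] at hs ⊢
    rw [← submatrix_map, ← reindex_apply, pencil_reindex, fromBlocks_map, pencil_fromBlocks]
    refine HasInertia.reindex (HasInertia.enlarge hs _ _ _ ?_ ?_ ?_ ?_ ?_) _ <;>
      simp [pencil, hα]
  | enlargeRow S a =>
    simp only [realPencil, reindex_apply] at hs ⊢
    rw [← submatrix_map, ← reindex_apply, pencil_reindex, fromBlocks_map, pencil_fromBlocks]
    refine HasInertia.reindex (HasInertia.enlarge hs _ _ _ ?_ ?_ ?_ ?_ ?_) _ <;>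
      simp [pencil, hα]

theorem hasInertia_iff_of_sEquivalent {α : ℂ} (hα : α ≠ 0) {S T : RealSquareMatrix}
    (h : SEquivalent S T) (s : ℤ) :
    HasInertia (realPencil α S.2) s ↔ HasInertia (realPencil α T.2) s := by
  induction h generalizing s with
  | rel S T h =>
    refine ⟨fun hs => hs.of_sMove hα h, fun hs => ?_⟩
    -- No inverse move is needed: the pencil of `S` has some signature, the move carries it to `T`,
    -- and uniqueness identifies it with `s`.
    have hS := hasInertia_hermitianSignature (pencil_isHermitian α (S.2.map Complex.ofRealHom))
    rwa [(HasInertia.of_sMove hα h hS).unique (pencil_isHermitian _ _) hs] at hS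
  | refl S => rfl
  | symm S T _ ih => exact (ih s).symm
  | trans S T R _ _ ih₁ ih₂ => exact (ih₁ s).trans (ih₂ s)

theorem HasInertia.of_isNondegeneratePart {α : ℂ} (hα : α ≠ 0) {m r : ℕ}
    {S : Matrix (Fin m) (Fin m) ℝ} {N : Matrix (Fin r) (Fin r) ℝ} (h : IsNondegeneratePart S N)
    {s : ℤ} (hs : HasInertia (realPencil α N) s) : HasInertia (realPencil α S) s := by
  obtain ⟨-, d, h⟩ := h
  refine (hasInertia_iff_of_sEquivalent hα h s).2 ?_
  simp only [realPencil, reindex_apply] at hs ⊢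
  rw [← submatrix_map, ← reindex_apply, pencil_reindex, fromBlocks_map, pencil_fromBlocks]
  have h0 := (HasInertia.zero (ι := Fin d)).fromBlocks hs
  rw [zero_add] at h0
  refine HasInertia.reindex ?_ _
  have hz : ∀ c d : ℕ, (0 : Matrix (Fin c) (Fin d) ℝ).map Complex.ofRealHom = 0 := fun _ _ =>
    Matrix.map_zero _ (map_zero _)
  simpa [hz, pencil] using h0

/-- As `N` is real, `N = N* (Nᵀ)⁻¹ N` is a congruence between `N` and the variation operator. -/
theorem HasInertia.of_ofSeifert {α : ℂ} {r : ℕ} {N : Matrix (Fin r) (Fin r) ℝ} (hN : IsUnit N)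
    {s : ℤ} (hs : HasInertia (pencil α (HVS.ofSeifert N hN).V) s) :
    HasInertia (realPencil α N) s := by
  have hd := (Matrix.isUnit_iff_isUnit_det _).1 hN
  have hd' : IsUnit Nᵀ.det := by rwa [Matrix.det_transpose]
  have hone : (1 : Matrix (Fin r) (Fin r) ℝ).map Complex.ofRealHom = 1 :=
    Matrix.map_one _ (map_zero _) (map_one _)
  have hc : (N.map Complex.ofRealHom)ᴴ = Nᵀ.map Complex.ofRealHom := by ext i j; simp
  refine HasInertia.pencil_congr hs (N.map Complex.ofRealHom) (N⁻¹.map Complex.ofRealHom) ?_ ?_ ?_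
  · rw [← Matrix.map_mul, nonsing_inv_mul _ hd, hone]
  · rw [← Matrix.map_mul, mul_nonsing_inv _ hd, hone]
  · rw [hc, HVS.ofSeifert, ← Matrix.map_mul, ← Matrix.map_mul, mul_nonsing_inv _ hd', one_mul]

theorem HVS.IsIsomorphic.hasInertia {n : ℕ} {α : ℂ} {X : HVS n ι} {Y : HVS n κ}
    (h : X.IsIsomorphic Y) {s : ℤ} (hs : HasInertia (pencil α Y.V) s) :
    HasInertia (pencil α X.V) s := by
  obtain ⟨φ, ψ, h₁, h₂, -, -, hV⟩ := h
  refine hs.pencil_congr ψᴴ φᴴ ?_ ?_ (by simpa using hV)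
  · rw [← conjTranspose_mul, h₁, conjTranspose_one]
  · rw [← conjTranspose_mul, h₂, conjTranspose_one]

theorem HVS.hasInertia_directSum {n : ℕ} {α : ℂ} {X : HVS n ι} {Y : HVS n κ} {s t : ℤ}
    (hX : HasInertia (pencil α X.V) s) (hY : HasInertia (pencil α Y.V) t) :
    HasInertia (pencil α (X.directSum Y).V) (s + t) := by
  rw [HVS.directSum, pencil_fromBlocks]
  simpa using hX.fromBlocks hY

theorem HVS.hasInertia_iDirectSum {n s : ℕ} {α : ℂ} {ν : Fin s → Type} [∀ i, Fintype (ν i)]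
    [∀ i, DecidableEq (ν i)] {X : ∀ i, HVS n (ν i)} {t : Fin s → ℤ}
    (h : ∀ i, HasInertia (pencil α (X i).V) (t i)) :
    HasInertia (pencil α (HVS.iDirectSum X).V) (∑ i, t i) := by
  rw [HVS.iDirectSum, pencil_blockDiagonal']
  exact HasInertia.blockDiagonal' h

omit [DecidableEq ι] [DecidableEq κ] in
theorem hasInertia_pencil_antidiag (α : ℂ) (B : Matrix ι κ ℂ) (C : Matrix κ ι ℂ) :
    HasInertia (pencil α (fromBlocks 0 B C 0)) 0 := by
  classical
  have h : pencil α (fromBlocks 0 B C 0) =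
      fromBlocks 0 (α • B + star α • Cᴴ) (α • B + star α • Cᴴ)ᴴ 0 := by
    rw [pencil_fromBlocks]
    simp [pencil, add_comm]
  rw [h]
  exact hasInertia_fromBlocks_antidiag _

theorem HVS.IsVBlock.hasInertia {n k : ℕ} {α μ : ℂ} {X : HVS n (Fin k ⊕ Fin k)}
    (h : X.IsVBlock μ) : HasInertia (pencil α X.V) 0 := by
  rw [h.2.2]
  exact hasInertia_pencil_antidiag _ _ _

theorem seifertForm_eq_realPencil {m : ℕ} (S : Matrix (Fin m) (Fin m) ℤ) (ζ : Circle) :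
    seifertForm S ζ = realPencil (1 - (ζ : ℂ)) (S.map (Int.cast : ℤ → ℝ)) := by
  ext i j
  simp [seifertForm, realPencil, pencil]

theorem seifertForm_inv {m : ℕ} (S : Matrix (Fin m) (Fin m) ℤ) (ζ : Circle) :
    seifertForm S ζ⁻¹ = (seifertForm S ζ)ᵀ := by
  ext i j
  have h : ((ζ⁻¹ : Circle) : ℂ) = star (ζ : ℂ) := Circle.coe_inv_eq_conj ζ
  simp only [seifertForm, h, star_star, Matrix.add_apply, Matrix.smul_apply, map_apply, transpose_apply,
    smul_eq_mul]
  ring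

theorem tristramLevine_inv {m : ℕ} (S : Matrix (Fin m) (Fin m) ℤ) (ζ : Circle) :
    tristramLevine S ζ⁻¹ = tristramLevine S ζ := by
  have h : ∀ (M : Matrix (Fin m) (Fin m) ℂ) (hM : M.IsHermitian), M = (seifertForm S ζ)ᵀ →
      hermitianSignature M hM = tristramLevine S ζ := by
    rintro M hM rfl
    exact hermitianSignature_transpose _ _
  exact h _ _ (seifertForm_inv S ζ)

end Pencil

/-! ### Anti-triangular hermitian matrices -/

section AntiTriangular

variable {k : ℕ}

theorem card_fin_val_lt (k a : ℕ) (h : a ≤ k) : Nat.card {i : Fin k // (i : ℕ) < a} = a := by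
  rw [Nat.card_eq_fintype_card, Fintype.card_subtype]
  obtain ⟨c, rfl⟩ := Nat.exists_eq_add_of_le h
  have : (Finset.univ.filter fun i : Fin (a + c) => (i : ℕ) < a) =
      (Finset.univ : Finset (Fin a)).map (Fin.castAddEmb c) := by
    ext i
    simp only [Finset.mem_filter, Finset.mem_univ, true_and, Finset.mem_map]
    exact ⟨fun hi => ⟨⟨i, hi⟩, rfl⟩, by rintro ⟨j, rfl⟩; simp⟩
  rw [this, Finset.card_map, Finset.card_fin]

/-- An anti-triangular matrix with nonzero entries on the `t`-th antidiagonal has small kernel. -/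
theorem ker_le_of_antiTriangular (H : Matrix (Fin k) (Fin k) ℂ) (t : ℕ) (hk : k ≤ t + 1)
    (h0 : ∀ i j : Fin k, (i : ℕ) + j < t → H i j = 0)
    (h1 : ∀ i j : Fin k, (i : ℕ) + j = t → H i j ≠ 0) :
    LinearMap.ker H.mulVecLin ≤ coordSubspace fun i : Fin k => (i : ℕ) < t + 1 - k := by
  intro x hx
  have hx' : H *ᵥ x = 0 := hx
  have key : ∀ d : ℕ, ∀ j : Fin k, (j : ℕ) + d + 1 = k → t < j + k → x j = 0 := by
    intro d
    induction d using Nat.strong_induction_on with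
    | _ d ih =>
      intro j hj hjt
      have hi : t - j < k := by omega
      have hrow := congrFun hx' ⟨t - j, hi⟩
      rw [mulVec, dotProduct, Finset.sum_eq_single j] at hrow
      · exact (mul_eq_zero.1 hrow).resolve_left (h1 _ _ (by simp only; omega))
      · intro l _ hl
        rcases lt_or_gt_of_ne (fun h => hl (Fin.ext h) : (l : ℕ) ≠ j) with h | h
        · rw [h0 _ _ (by simp only; omega), zero_mul]
        · rw [ih (k - 1 - l) (by omega) l (by omega) (by omega), mul_zero]
      · simp
  intro i hi
  exact key (k - 1 - i) i (by omega) (by omega)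

theorem formValue_of_diagonal_on (H : Matrix (Fin k) (Fin k) ℂ) (a : ℕ)
    (h : ∀ i j : Fin k, (i : ℕ) < a → (j : ℕ) < a → i ≠ j → H i j = 0) (x : Fin k → ℂ)
    (hx : x ∈ coordSubspace fun i : Fin k => (i : ℕ) < a) :
    formValue H x = ∑ i, (H i i * (Complex.normSq (x i) : ℂ)).re := by
  rw [formValue, dotProduct, Complex.re_sum]
  refine Finset.sum_congr rfl fun i _ => ?_
  by_cases hi : (i : ℕ) < a
  · rw [mulVec, dotProduct, Finset.sum_eq_single i, Complex.normSq_eq_conj_mul_self]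
    · congr 1
      simp only [Pi.star_apply, starRingEnd_apply]
      ring
    · intro j _ hj
      by_cases hj' : (j : ℕ) < a
      · rw [h i j hi hj' hj.symm, zero_mul]
      · rw [hx j hj', mul_zero]
    · simp
  · simp [hx i hi]

/-- The witnesses are the spans of the first `a` and the first `b` basis vectors. The bounds `2 * a
≤ t + 2` and `2 * b ≤ t + 2` put all off-diagonal entries of these corners before the `t`-th
antidiagonal, so the restricted forms are diagonal. The kernel has dimension at most `t + 1 - k`,
which matches `a + b = t + 1`. -/
theorem HasInertia.of_antiTriangular (H : Matrix (Fin k) (Fin k) ℂ) (t a b : ℕ) (hk : k ≤ t + 1)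
    (h0 : ∀ i j : Fin k, (i : ℕ) + j < t → H i j = 0)
    (h1 : ∀ i j : Fin k, (i : ℕ) + j = t → H i j ≠ 0) (ha : a ≤ k) (hb : b ≤ k)
    (hab : a + b = t + 1) (ha' : 2 * a ≤ t + 2) (hb' : 2 * b ≤ t + 2)
    (hpos : ∀ i : Fin k, (i : ℕ) < a → 0 ≤ (H i i).re)
    (hneg : ∀ i : Fin k, (i : ℕ) < b → (H i i).re ≤ 0) : HasInertia H ((a : ℤ) - b) := by
  refine ⟨coordSubspace fun i => (i : ℕ) < a, coordSubspace fun i => (i : ℕ) < b, a, b,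
    fun x hx => ?_, fun x hx => ?_, ?_, ?_, ?_, rfl⟩
  · rw [formValue_of_diagonal_on H a (fun i j hi hj hij => h0 i j ?_) x hx]
    · refine Finset.sum_nonneg fun i _ => ?_
      rw [Complex.re_mul_ofReal]
      by_cases hi : (i : ℕ) < a
      · exact mul_nonneg (hpos i hi) (Complex.normSq_nonneg _)
      · simp [hx i hi]
    · have : (i : ℕ) ≠ j := fun h => hij (Fin.ext h)
      omega
  · rw [formValue_of_diagonal_on H b (fun i j hi hj hij => h0 i j ?_) x hx]
    · refine Finset.sum_nonpos fun i _ => ?_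
      rw [Complex.re_mul_ofReal]
      by_cases hi : (i : ℕ) < b
      · exact mul_nonpos_of_nonpos_of_nonneg (hneg i hi) (Complex.normSq_nonneg _)
      · simp [hx i hi]
    · have : (i : ℕ) ≠ j := fun h => hij (Fin.ext h)
      omega
  · exact (card_fin_val_lt k a ha).symm.le.trans (card_le_finrank_coordSubspace _)
  · exact (card_fin_val_lt k b hb).symm.le.trans (card_le_finrank_coordSubspace _)
  · have h := finrank_le_card_of_le_coordSubspace _ _ (ker_le_of_antiTriangular H t hk h0 h1)
    rw [card_fin_val_lt k _ (by omega)] at h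
    rw [Fintype.card_fin]
    omega

/-- The signature of an anti-triangular matrix with an odd number of antidiagonals above and on
the nonzero one is the sign `u` of its middle entry. -/
theorem HasInertia.of_antiTriangular_even (H : Matrix (Fin k) (Fin k) ℂ) (m : ℕ) (u : ℤˣ)
    (hm : m < k) (hk : k ≤ 2 * m + 1)
    (h0 : ∀ i j : Fin k, (i : ℕ) + j < 2 * m → H i j = 0)
    (h1 : ∀ i j : Fin k, (i : ℕ) + j = 2 * m → H i j ≠ 0)
    (hu : ∀ i : Fin k, (i : ℕ) = m → 0 ≤ ((u : ℤ) : ℝ) * (H i i).re) : HasInertia H u := by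
  have hz : ∀ i : Fin k, (i : ℕ) < m → (H i i).re = 0 := fun i hi => by
    rw [h0 i i (by omega), Complex.zero_re]
  rcases Int.units_eq_one_or u with rfl | rfl
  · have h := HasInertia.of_antiTriangular H (2 * m) (m + 1) m hk h0 h1 (by omega) (by omega)
      (by omega) (by omega) (by omega) (fun i hi => ?_) (fun i hi => (hz i hi).le)
    · simpa using h
    · rcases Nat.lt_succ_iff_lt_or_eq.1 hi with h | h
      · exact (hz i h).ge
      · simpa using hu i h
  · have h := HasInertia.of_antiTriangular H (2 * m) m (m + 1) hk h0 h1 (by omega) (by omega)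
      (by omega) (by omega) (by omega) (fun i hi => (hz i hi).ge) (fun i hi => ?_)
    · simpa using h
    · rcases Nat.lt_succ_iff_lt_or_eq.1 hi with h | h
      · exact (hz i h).le
      · simpa using hu i h

theorem HasInertia.of_antiTriangular_odd (H : Matrix (Fin k) (Fin k) ℂ) (m : ℕ)
    (hm : m < k) (hk : k ≤ 2 * m + 2)
    (h0 : ∀ i j : Fin k, (i : ℕ) + j < 2 * m + 1 → H i j = 0)
    (h1 : ∀ i j : Fin k, (i : ℕ) + j = 2 * m + 1 → H i j ≠ 0) : HasInertia H 0 := by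
  have hz : ∀ i : Fin k, (i : ℕ) < m + 1 → (H i i).re = 0 := fun i hi => by
    rw [h0 i i (by omega), Complex.zero_re]
  have h := HasInertia.of_antiTriangular H (2 * m + 1) (m + 1) (m + 1) hk h0 h1 (by omega)
    (by omega) (by omega) (by omega) (by omega) (fun i hi => (hz i hi).ge)
    (fun i hi => (hz i hi).le)
  simpa using h

end AntiTriangular

/-! ### Forms preserved by a Jordan block -/

section Jordan

variable {k : ℕ}

theorem mul_jordanOne_apply_zero (M : Matrix (Fin k) (Fin k) ℂ) (i j : Fin k)
    (hj : (j : ℕ) = 0) : (M * jordanOne k) i j = M i j := by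
  rw [Matrix.mul_apply, Finset.sum_eq_single j]
  · simp [jordanOne]
  · intro l _ hl
    simp [jordanOne, hl, hj]
  · simp

theorem mul_jordanOne_apply_succ (M : Matrix (Fin k) (Fin k) ℂ) (i j' j : Fin k)
    (hj : (j' : ℕ) + 1 = j) : (M * jordanOne k) i j = M i j + M i j' := by
  have hne : j ≠ j' := fun h => by rw [h] at hj; omega
  rw [Matrix.mul_apply, Finset.sum_eq_add j j' hne]
  · simp [jordanOne, hj]
  · intro l _ hl
    have : (l : ℕ) + 1 ≠ j := fun h => hl.2 (Fin.ext (by omega))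
    simp [jordanOne, hl.1, this]
  · simp
  · simp

theorem conjTranspose_jordanOne_mul_apply_zero (M : Matrix (Fin k) (Fin k) ℂ) (i j : Fin k)
    (hi : (i : ℕ) = 0) : ((jordanOne k)ᴴ * M) i j = M i j := by
  have h := mul_jordanOne_apply_zero Mᴴ j i hi
  rw [← conjTranspose_conjTranspose ((jordanOne k)ᴴ * M), conjTranspose_mul,
    conjTranspose_conjTranspose, conjTranspose_apply, h]
  simp

theorem conjTranspose_jordanOne_mul_apply_succ (M : Matrix (Fin k) (Fin k) ℂ) (i' i j : Fin k)
    (hi : (i' : ℕ) + 1 = i) : ((jordanOne k)ᴴ * M) i j = M i j + M i' j := by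
  have h := mul_jordanOne_apply_succ Mᴴ j i' i hi
  rw [← conjTranspose_conjTranspose ((jordanOne k)ᴴ * M), conjTranspose_mul,
    conjTranspose_conjTranspose, conjTranspose_apply, h]
  simp

variable {B : Matrix (Fin k) (Fin k) ℂ}

theorem apply_first_eq_zero (hB : (jordanOne k)ᴴ * B * jordanOne k = B) (i j : Fin k)
    (hi : (i : ℕ) = 0) (hj : (j : ℕ) + 1 < k) : B i j = 0 := by
  have h := congrFun (congrFun hB i) ⟨j + 1, hj⟩
  rw [mul_jordanOne_apply_succ _ i j _ rfl, conjTranspose_jordanOne_mul_apply_zero _ _ _ hi,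
    conjTranspose_jordanOne_mul_apply_zero _ _ _ hi] at h
  simpa using h

theorem apply_succ_eq (hB : (jordanOne k)ᴴ * B * jordanOne k = B) (i' i j j' : Fin k)
    (hi : (i' : ℕ) + 1 = i) (hj : (j : ℕ) + 1 = j') : B i j = -B i' j' - B i' j := by
  have h := congrFun (congrFun hB i) j'
  rw [mul_jordanOne_apply_succ _ i j _ hj, conjTranspose_jordanOne_mul_apply_succ _ i' i _ hi,
    conjTranspose_jordanOne_mul_apply_succ _ i' i _ hi] at h
  linear_combination h

/-- Comparing entries of `J* B J = B` shows that the first row vanishes except in its last entry;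
`apply_succ_eq` expresses each further row through the previous one. -/
theorem apply_eq_zero_of_jordan (hB : (jordanOne k)ᴴ * B * jordanOne k = B) (i j : Fin k)
    (h : (i : ℕ) + j + 1 < k) : B i j = 0 := by
  obtain ⟨i, hi⟩ := i
  induction i generalizing j with
  | zero => exact apply_first_eq_zero hB _ j rfl (by simpa using h)
  | succ i ih =>
    simp only at h
    rw [apply_succ_eq hB ⟨i, by omega⟩ _ j ⟨j + 1, by omega⟩ rfl rfl,
      ih _ _ (by simp only; omega), ih _ _ (by simp only; omega)]
    simp

theorem apply_antidiag_of_jordan (hB : (jordanOne k)ᴴ * B * jordanOne k = B) {w : ℂ}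
    (hw : ∀ i j : Fin k, (i : ℕ) = 0 → (j : ℕ) + 1 = k → B i j = w) (i j : Fin k)
    (h : (i : ℕ) + j + 1 = k) : B i j = (-1) ^ (i : ℕ) * w := by
  obtain ⟨i, hi⟩ := i
  induction i generalizing j with
  | zero => simpa using hw _ j rfl (by simpa using h)
  | succ i ih =>
    simp only at h
    rw [apply_succ_eq hB ⟨i, by omega⟩ _ j ⟨j + 1, by omega⟩ rfl rfl,
      ih _ _ (by simp only; omega),
      apply_eq_zero_of_jordan hB ⟨i, by omega⟩ j (by simp only; omega)]
    ring

end Jordan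

/-- Multiplication by the Jordan block adds the entry to the left, which lies strictly before the
antidiagonal and vanishes. -/
theorem mul_jordanOne_apply_of_le {k : ℕ} {B : Matrix (Fin k) (Fin k) ℂ}
    (hB : (jordanOne k)ᴴ * B * jordanOne k = B) (i j : Fin k) (h : (i : ℕ) + j + 1 ≤ k) :
    (B * jordanOne k) i j = B i j := by
  rcases Nat.eq_zero_or_pos (j : ℕ) with hj | hj
  · exact mul_jordanOne_apply_zero B i j hj
  · have h0 : B i ⟨j - 1, by omega⟩ = 0 := apply_eq_zero_of_jordan hB _ _ (by simp only; omega)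
    rw [mul_jordanOne_apply_succ B i ⟨j - 1, by omega⟩ j (by simp only; omega), h0, add_zero]

/-- This cancels the alternating sign along the antidiagonal against the power of `i` in the corner
entry, so that the decisive middle entry is a real multiple of `u`. -/
theorem neg_one_pow_mul_I_zpow_neg (m : ℕ) :
    (-1 : ℂ) ^ m * Complex.I ^ (-(2 * m : ℤ)) = 1 := by
  rw [_root_.zpow_neg, _root_.zpow_mul, zpow_natCast]
  have : Complex.I ^ (2 : ℤ) = -1 := by exact_mod_cast Complex.I_sq
  rw [this]
  exact mul_inv_cancel₀ (pow_ne_zero _ (by norm_num))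

/-! ### Signatures of the indecomposable blocks -/

section Blocks

variable {k : ℕ} {u : ℤˣ} {b : Matrix (Fin k) (Fin k) ℂ}

theorem pencil_apply (α : ℂ) (A : Matrix (Fin k) (Fin k) ℂ) (i j : Fin k) :
    pencil α A i j = α * A i j + star α * star (A j i) := rfl

theorem units_cast_ne_zero (u : ℤˣ) : ((u : ℤ) : ℂ) ≠ 0 :=
  Int.cast_ne_zero.2 u.ne_zero

theorem units_cast_mul_self (u : ℤˣ) : ((u : ℤ) : ℝ) * ((u : ℤ) : ℝ) = 1 := by
  rcases Int.units_eq_one_or u with rfl | rfl <;> simp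

theorem IsBForm.conjTranspose_eq (hb : IsBForm 1 k u b) : bᴴ = -b := by
  simpa using hb.1

theorem IsBForm.star_apply (hb : IsBForm 1 k u b) (i j : Fin k) : star (b j i) = -b i j := by
  have := congrFun (congrFun hb.conjTranspose_eq i) j
  simpa using this

theorem IsBForm.antidiag (hb : IsBForm 1 k u b) (i j : Fin k) (h : (i : ℕ) + j + 1 = k) :
    b i j = (-1) ^ (i : ℕ) * (((u : ℤ) : ℂ) * Complex.I ^ (-(k : ℤ))) := by
  refine apply_antidiag_of_jordan hb.2.2.1 (fun i j hi hj => ?_) i j h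
  rw [hb.2.2.2 i j hi hj]
  congr 2
  push_cast
  ring

theorem IsBForm.antidiag_ne_zero (hb : IsBForm 1 k u b) (i j : Fin k) (h : (i : ℕ) + j + 1 = k) :
    b i j ≠ 0 := by
  rw [hb.antidiag i j h]
  exact mul_ne_zero (pow_ne_zero _ (by norm_num))
    (mul_ne_zero (units_cast_ne_zero u) (zpow_ne_zero _ Complex.I_ne_zero))

/-- In this range `J` acts on `b` like the identity. Since `b` is skew-hermitian, the pencil
produces `z - z̄` with `z = α (1 - c)`. -/
theorem IsBForm.pencil_apply_of_le (hb : IsBForm 1 k u b) (α c : ℂ) (i j : Fin k)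
    (h : (i : ℕ) + j + 1 ≤ k) : pencil α (b - c • (b * jordanOne k)) i j =
      2 * ((α * (1 - c)).im : ℂ) * Complex.I * b i j := by
  have hz := Complex.sub_conj (α * (1 - c))
  rw [pencil_apply, Matrix.sub_apply, Matrix.sub_apply, Matrix.smul_apply, Matrix.smul_apply,
    mul_jordanOne_apply_of_le hb.2.2.1 i j h, mul_jordanOne_apply_of_le hb.2.2.1 j i (by omega)]
  simp only [smul_eq_mul, star_sub, star_mul', hb.star_apply]
  simp only [map_mul, map_sub, map_one, starRingEnd_apply] at hz
  push_cast at hz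
  linear_combination (b i j) * hz

/-- One antidiagonal further, the `b i j` terms cancel because `α (1 - c)` is real. What survives
comes from the off-diagonal part of `J`, and the alternation of the antidiagonal of `b` combines it
to `αc` plus its conjugate. -/
theorem IsBForm.pencil_apply_succ (hb : IsBForm 1 k u b) (α c : ℂ) (hD : (α * (1 - c)).im = 0)
    (i j j' : Fin k) (hj : (j' : ℕ) + 1 = j) (h : (i : ℕ) + j = k) :
    pencil α (b - c • (b * jordanOne k)) i j = -(2 * ((α * c).re : ℂ)) * b i j' := by
  have hz := Complex.sub_conj (α * (1 - c))
  have hr := Complex.add_conj (α * c)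
  have hi : (i : ℕ) - 1 + 1 = i := by omega
  have hi' : (i : ℕ) - 1 < k := by omega
  have hs := apply_succ_eq hb.2.2.1 ⟨i - 1, hi'⟩ i j' j hi hj
  rw [apply_eq_zero_of_jordan hb.2.2.1 ⟨i - 1, hi'⟩ j' (by simp only; omega)] at hs
  rw [pencil_apply, Matrix.sub_apply, Matrix.sub_apply, Matrix.smul_apply, Matrix.smul_apply,
    mul_jordanOne_apply_succ b i j' j hj, mul_jordanOne_apply_succ b j ⟨i - 1, hi'⟩ i hi]
  simp only [smul_eq_mul, star_sub, star_mul', star_add, hb.star_apply]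
  simp only [map_mul, map_sub, map_one, starRingEnd_apply, hD] at hz hr
  push_cast at hz hr
  linear_combination (b i j) * hz - b i j' * hr + star α * star c * hs

theorem IsBForm.hasInertia_of_im_ne_zero (hb : IsBForm 1 k u b) (hk : 1 ≤ k) {α c : ℂ}
    (hD : (α * (1 - c)).im ≠ 0) : HasInertia (pencil α (b - c • (b * jordanOne k)))
      (if Odd k then if (α * (1 - c)).im < 0 then -(u : ℤ) else u else 0) := by
  have h0 : ∀ i j : Fin k, (i : ℕ) + j + 1 < k →
      pencil α (b - c • (b * jordanOne k)) i j = 0 := fun i j h => by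
    rw [hb.pencil_apply_of_le α c i j h.le, apply_eq_zero_of_jordan hb.2.2.1 i j h, mul_zero]
  have h1 : ∀ i j : Fin k, (i : ℕ) + j + 1 = k →
      pencil α (b - c • (b * jordanOne k)) i j ≠ 0 := fun i j h => by
    rw [hb.pencil_apply_of_le α c i j h.le]
    exact mul_ne_zero (mul_ne_zero (mul_ne_zero two_ne_zero (Complex.ofReal_ne_zero.2 hD))
      Complex.I_ne_zero) (hb.antidiag_ne_zero i j h)
  have hmid : ∀ m, k = 2 * m + 1 → ∀ v : ℤˣ, 0 ≤ ((v : ℤ) : ℝ) * ((α * (1 - c)).im * (u : ℤ)) →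
      HasInertia (pencil α (b - c • (b * jordanOne k))) v := fun m hm v hv => by
    refine HasInertia.of_antiTriangular_even _ m v (by omega) (by omega)
      (fun i j h => h0 i j (by omega)) (fun i j h => h1 i j (by omega)) fun i hi => ?_
    have hI := neg_one_pow_mul_I_zpow_neg m
    have hI' : Complex.I ^ (-(k : ℤ)) * Complex.I = Complex.I ^ (-(2 * m : ℤ)) := by
      rw [← zpow_add_one₀ Complex.I_ne_zero]
      congr 1
      omega
    rw [hb.pencil_apply_of_le α c i i (by omega), hb.antidiag i i (by omega), hi]
    have : 2 * ((α * (1 - c)).im : ℂ) * Complex.I *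
        ((-1) ^ m * (((u : ℤ) : ℂ) * Complex.I ^ (-(k : ℤ)))) =
        ((2 * ((α * (1 - c)).im * ((u : ℤ) : ℝ)) : ℝ) : ℂ) := by
      rw [← hI'] at hI
      push_cast
      linear_combination (2 * ((α * (1 - c)).im : ℂ) * ((u : ℤ) : ℂ)) * hI
    rw [this, Complex.ofReal_re]
    linarith
  have hu := units_cast_mul_self u
  split_ifs with hodd hneg
  · obtain ⟨m, hm⟩ := hodd
    rw [← Units.val_neg]
    refine hmid m hm _ ?_
    rw [Units.val_neg, Int.cast_neg, mul_left_comm, neg_mul, hu]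
    linarith
  · obtain ⟨m, hm⟩ := hodd
    refine hmid m hm _ ?_
    rw [mul_left_comm, hu]
    linarith
  · obtain ⟨m, hm⟩ := Nat.not_odd_iff_even.1 hodd
    exact HasInertia.of_antiTriangular_odd _ (m - 1) (by omega) (by omega)
      (fun i j h => h0 i j (by omega)) (fun i j h => h1 i j (by omega))

/-- The first nonzero antidiagonal is now `i + j = k`, which meets the diagonal exactly when `k` is
even. -/
theorem IsBForm.hasInertia_of_im_eq_zero (hb : IsBForm 1 k u b) (hk : 1 ≤ k) {α c : ℂ}
    (hD : (α * (1 - c)).im = 0) (hE : (α * c).re < 0) :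
    HasInertia (pencil α (b - c • (b * jordanOne k))) (if Odd k then 0 else u) := by
  have h0 : ∀ i j : Fin k, (i : ℕ) + j < k →
      pencil α (b - c • (b * jordanOne k)) i j = 0 := fun i j h => by
    rw [hb.pencil_apply_of_le α c i j h, hD]
    simp
  have h1 : ∀ i j : Fin k, (i : ℕ) + j = k →
      pencil α (b - c • (b * jordanOne k)) i j ≠ 0 := fun i j h => by
    rw [hb.pencil_apply_succ α c hD i j ⟨j - 1, by omega⟩ (by simp only; omega) h]
    exact mul_ne_zero (neg_ne_zero.2 (mul_ne_zero two_ne_zero (Complex.ofReal_ne_zero.2 hE.ne)))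
      (hb.antidiag_ne_zero _ _ (by simp only; omega))
  split_ifs with hodd
  · obtain ⟨m, hm⟩ := hodd
    exact HasInertia.of_antiTriangular_odd _ m (by omega) (by omega)
      (fun i j h => h0 i j (by omega)) (fun i j h => h1 i j (by omega))
  · obtain ⟨m, hm⟩ := Nat.not_odd_iff_even.1 hodd
    refine HasInertia.of_antiTriangular_even _ m u (by omega) (by omega)
      (fun i j h => h0 i j (by omega)) (fun i j h => h1 i j (by omega)) fun i hi => ?_
    rw [hb.pencil_apply_succ α c hD i i ⟨i - 1, by omega⟩ (by simp only; omega) (by omega),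
      hb.antidiag _ _ (by simp only; omega), hi,
      show (-(k : ℤ)) = -(2 * m : ℤ) by omega, mul_left_comm ((-1 : ℂ) ^ m),
      neg_one_pow_mul_I_zpow_neg, mul_one]
    have : (-(2 * ((α * c).re : ℂ)) * ((u : ℤ) : ℂ)).re = -(2 * (α * c).re) * ((u : ℤ) : ℝ) := by
      rw [← Complex.ofReal_re (-(2 * (α * c).re) * ((u : ℤ) : ℝ))]
      push_cast
      rfl
    rw [this, mul_left_comm, units_cast_mul_self]
    linarith

/-- Because `b` is skew-hermitian, `V = (b⁻¹)* (b - lam b J) b⁻¹`. -/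
theorem HVS.IsUnitaryBlock.hasInertia {X : HVS 1 (Fin k)} {lam : Circle}
    (h : X.IsUnitaryBlock lam u) {α : ℂ} {s : ℤ}
    (hs : HasInertia (pencil α (X.b - (lam : ℂ) • (X.b * jordanOne k))) s) :
    HasInertia (pencil α X.V) s := by
  obtain ⟨hb, -, hV⟩ := h
  have hd := (Matrix.isUnit_iff_isUnit_det _).1 hb.2.1
  refine hs.pencil_congr X.b⁻¹ X.b (mul_nonsing_inv _ hd) (nonsing_inv_mul _ hd) ?_
  rw [hV, conjTranspose_nonsing_inv, hb.conjTranspose_eq]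
  have hn : (-X.b)⁻¹ = -X.b⁻¹ := by
    refine inv_eq_right_inv ?_
    rw [neg_mul_neg, mul_nonsing_inv _ hd]
  have hx : X.b - (lam : ℂ) • (X.b * jordanOne k) = -(X.b * ((lam : ℂ) • jordanOne k - 1)) := by
    rw [Matrix.mul_sub, Matrix.mul_smul, Matrix.mul_one, neg_sub]
  rw [hn, hx, neg_mul_neg, ← Matrix.mul_assoc X.b⁻¹, nonsing_inv_mul _ hd, Matrix.one_mul]

theorem HVS.IsUnipotentBlock.hasInertia {X : HVS 1 (Fin k)} (h : X.IsUnipotentBlock u)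
    (hk : 1 ≤ k) {α : ℂ} (hα : 0 < α.re) :
    HasInertia (pencil α X.V) (if Odd k then -(u : ℤ) else 0) := by
  obtain ⟨hJ, hX, -, -, hw⟩ := h
  have hd := (Matrix.isUnit_iff_isUnit_det _).1 hX
  set L := X.V⁻¹ with hL
  have hVL : X.V * L = 1 := mul_nonsing_inv _ hd
  have hLV : L * X.V = 1 := nonsing_inv_mul _ hd
  have hLV' : Lᴴ * X.Vᴴ = 1 := by rw [← conjTranspose_mul, hVL, conjTranspose_one]
  have hVL' : X.Vᴴ * Lᴴ = 1 := by rw [← conjTranspose_mul, hLV, conjTranspose_one]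
  have hV : X.V = jordanOne k * X.Vᴴ := by
    have := congrArg conjTranspose X.V_conjTranspose
    simpa [hJ] using this
  have hLJ : Lᴴ = L * jordanOne k := by
    calc Lᴴ = L * X.V * Lᴴ := by rw [hLV, Matrix.one_mul]
      _ = L * (jordanOne k * X.Vᴴ) * Lᴴ := by rw [← hV]
      _ = L * jordanOne k * (X.Vᴴ * Lᴴ) := by simp only [Matrix.mul_assoc]
      _ = L * jordanOne k := by rw [hVL', Matrix.mul_one]
  -- Applying `L* = L J` twice gives `J* L J = J* L* = (L J)* = L`, so the inverse of `V` is itself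
  -- preserved by the Jordan block.
  have hB : (jordanOne k)ᴴ * L * jordanOne k = L := by
    rw [Matrix.mul_assoc, ← hLJ, ← conjTranspose_mul, ← hLJ, conjTranspose_conjTranspose]
  have hsuff : ∀ s, HasInertia (pencil α Lᴴ) s → HasInertia (pencil α X.V) s := fun s hs => by
    refine hs.pencil_congr X.Vᴴ Lᴴ hLV' hVL' ?_
    rw [conjTranspose_conjTranspose, Matrix.mul_assoc, hLV', Matrix.mul_one]
  apply hsuff
  have hle : ∀ i j : Fin k, (i : ℕ) + j + 1 ≤ k → pencil α Lᴴ i j = 2 * (α.re : ℂ) * L i j := by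
    intro i j h
    have hr := Complex.add_conj α
    have e : Lᴴ i j = L i j := by rw [hLJ, mul_jordanOne_apply_of_le hB i j h]
    have e' : star (Lᴴ j i) = L i j := by simp
    rw [pencil_apply, e, e']
    push_cast at hr
    rw [starRingEnd_apply] at hr
    linear_combination L i j * hr
  have hanti : ∀ i j : Fin k, (i : ℕ) + j + 1 = k →
      L i j = (-1) ^ (i : ℕ) * (((u : ℤ) : ℂ) * Complex.I ^ (-1 - (k : ℤ))) := by
    refine apply_antidiag_of_jordan hB fun i j hi hj => ?_
    rw [hw i j hi hj]
    norm_num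
  have h0 : ∀ i j : Fin k, (i : ℕ) + j + 1 < k → pencil α Lᴴ i j = 0 := fun i j h => by
    rw [hle i j h.le, apply_eq_zero_of_jordan hB i j h, mul_zero]
  have h1 : ∀ i j : Fin k, (i : ℕ) + j + 1 = k → pencil α Lᴴ i j ≠ 0 := fun i j h => by
    rw [hle i j h.le, hanti i j h]
    exact mul_ne_zero (mul_ne_zero two_ne_zero (Complex.ofReal_ne_zero.2 hα.ne'))
      (mul_ne_zero (pow_ne_zero _ (by norm_num))
        (mul_ne_zero (units_cast_ne_zero u) (zpow_ne_zero _ Complex.I_ne_zero)))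
  split_ifs with hodd
  · obtain ⟨m, hm⟩ := hodd
    rw [← Units.val_neg]
    refine HasInertia.of_antiTriangular_even _ m (-u) (by omega) (by omega)
      (fun i j h => h0 i j (by omega)) (fun i j h => h1 i j (by omega)) fun i hi => ?_
    -- The exponent `-1 - k` equals `-2 (m + 1)`, whereas the antidiagonal sign is `(-1) ^ m`. The
    -- mismatch of one is the source of the sign `-u`.
    have hI := neg_one_pow_mul_I_zpow_neg (m + 1)
    rw [hle i i (by omega), hanti i i (by omega), hi,
      show (-1 - (k : ℤ)) = -(2 * (m + 1 : ℕ) : ℤ) by push_cast; omega]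
    have : 2 * (α.re : ℂ) * ((-1) ^ m * (((u : ℤ) : ℂ) *
        Complex.I ^ (-(2 * (m + 1 : ℕ) : ℤ)))) = ((-(2 * α.re) * ((u : ℤ) : ℝ) : ℝ) : ℂ) := by
      push_cast at hI ⊢
      linear_combination (-2 * (α.re : ℂ) * ((u : ℤ) : ℂ)) * hI
    rw [this, Complex.ofReal_re, Units.val_neg, Int.cast_neg]
    have hu := units_cast_mul_self u
    nlinarith
  · obtain ⟨m, hm⟩ := Nat.not_odd_iff_even.1 hodd
    exact HasInertia.of_antiTriangular_odd _ (m - 1) (by omega) (by omega)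
      (fun i j h => h0 i j (by omega)) (fun i j h => h1 i j (by omega))

end Blocks

/-! ### The order of the unit circle -/

section CircleOrder

/-- The argument of a point of the unit circle, as a number in `[0, 1)`. -/
noncomputable def circleParam (z : Circle) : ℝ := Int.fract (Complex.arg z / (2 * Real.pi))

theorem circleParam_mem (z : Circle) : circleParam z ∈ Set.Ico (0 : ℝ) 1 :=
  ⟨Int.fract_nonneg _, Int.fract_lt_one _⟩

theorem exp_circleParam (z : Circle) : Circle.exp (2 * Real.pi * circleParam z) = z := by
  rw [circleParam, ← Int.self_sub_floor, mul_sub,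
    mul_div_cancel₀ _ (mul_ne_zero two_ne_zero Real.pi_ne_zero)]
  conv_rhs => rw [← Circle.exp_arg z]
  rw [Circle.exp_eq_exp]
  exact ⟨-⌊Complex.arg z / (2 * Real.pi)⌋, by push_cast; ring⟩

theorem circleParam_exp {x : ℝ} (hx : x ∈ Set.Ico (0 : ℝ) 1) :
    circleParam (Circle.exp (2 * Real.pi * x)) = x := by
  obtain ⟨m, hm⟩ := Circle.exp_eq_exp.1 (exp_circleParam (Circle.exp (2 * Real.pi * x)))
  set y := circleParam (Circle.exp (2 * Real.pi * x)) with hy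
  have hpi : (2 * Real.pi) ≠ 0 := mul_ne_zero two_ne_zero Real.pi_ne_zero
  have h : y = x + m := mul_left_cancel₀ hpi (by linarith)
  have hyf : Int.fract y = y := Int.fract_eq_self.2 (circleParam_mem _)
  rw [h, Int.fract_add_intCast, Int.fract_eq_self.2 hx] at hyf
  linarith

theorem circleParam_injective : Function.Injective circleParam := fun z w h => by
  rw [← exp_circleParam z, h, exp_circleParam]

theorem circleParam_one : circleParam 1 = 0 := by simp [circleParam]

theorem circleParam_pos {z : Circle} (hz : z ≠ 1) : 0 < circleParam z :=
  (circleParam_mem z).1.lt_of_ne fun h =>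
    hz (circleParam_injective (by rw [← h, circleParam_one]))

theorem circleLT_iff (z w : Circle) : CircleLT z w ↔ circleParam z < circleParam w := by
  constructor
  · rintro ⟨x, hx, y, hy, rfl, rfl, h⟩
    rwa [circleParam_exp hx, circleParam_exp hy]
  · exact fun h => ⟨_, circleParam_mem z, _, circleParam_mem w, (exp_circleParam z).symm,
      (exp_circleParam w).symm, h⟩

/-- With half angles `a` of `w` and `b` of `z`, the product is `4 sin a sin b e^{i(a - b)}`. -/
theorem im_one_sub_star_mul_one_sub (z w : Circle) :
    ((1 - star (z : ℂ)) * (1 - (w : ℂ))).im = -(4 * Real.sin (Real.pi * circleParam w) *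
      Real.sin (Real.pi * circleParam z) *
      Real.sin (Real.pi * (circleParam z - circleParam w))) := by
  have key : ∀ a b : ℝ, ((1 - star (Circle.exp (2 * b) : ℂ)) * (1 - (Circle.exp (2 * a) : ℂ))).im =
      -(4 * Real.sin a * Real.sin b * Real.sin (b - a)) := fun a b => by
    have hr : ∀ x : ℝ, (Circle.exp x : ℂ).re = Real.cos x := fun x => by
      rw [Circle.coe_exp, Complex.exp_ofReal_mul_I_re]
    have hi : ∀ x : ℝ, (Circle.exp x : ℂ).im = Real.sin x := fun x => by
      rw [Circle.coe_exp, Complex.exp_ofReal_mul_I_im]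
    simp only [Complex.mul_im, Complex.sub_re, Complex.sub_im, Complex.one_re, Complex.one_im,
      Complex.star_def, Complex.conj_re, Complex.conj_im, hr, hi, Real.sin_two_mul,
      Real.cos_two_mul, Real.sin_sub]
    have ha := Real.sin_sq_add_cos_sq a
    have hb := Real.sin_sq_add_cos_sq b
    linear_combination (-4 * Real.sin b * Real.cos b) * ha + (4 * Real.sin a * Real.cos a) * hb
  have h := key (Real.pi * circleParam w) (Real.pi * circleParam z)
  rwa [← mul_assoc, ← mul_assoc, exp_circleParam, exp_circleParam, ← mul_sub] at h

theorem im_neg_of_circleLT {z w : Circle} (hw : w ≠ 1) (h : CircleLT w z) :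
    ((1 - star (z : ℂ)) * (1 - (w : ℂ))).im < 0 := by
  rw [circleLT_iff] at h
  have hw' := circleParam_pos hw
  have hz := (circleParam_mem z).2
  rw [im_one_sub_star_mul_one_sub]
  have hs : ∀ x : ℝ, 0 < x → x < 1 → 0 < Real.sin (Real.pi * x) := fun x h0 h1 =>
    Real.sin_pos_of_pos_of_lt_pi (mul_pos Real.pi_pos h0) (by nlinarith [Real.pi_pos])
  have := mul_pos (mul_pos (hs (circleParam w) hw' (by linarith))
    (hs (circleParam z) (by linarith) hz)) (hs (circleParam z - circleParam w) (by linarith)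
    (by linarith))
  linarith

theorem im_pos_of_circleLT {z w : Circle} (hz : z ≠ 1) (h : CircleLT z w) :
    0 < ((1 - star (z : ℂ)) * (1 - (w : ℂ))).im := by
  have h' := im_neg_of_circleLT hz h
  have : (1 - star (w : ℂ)) * (1 - (z : ℂ)) = star ((1 - star (z : ℂ)) * (1 - (w : ℂ))) := by
    simp [mul_comm]
  have hc : (star ((1 - star (z : ℂ)) * (1 - (w : ℂ)))).im =
      -((1 - star (z : ℂ)) * (1 - (w : ℂ))).im := Complex.conj_im _
  rw [this, hc] at h'
  linarith

theorem circleLT_trichotomy (z w : Circle) : CircleLT z w ∨ z = w ∨ CircleLT w z := by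
  simp only [circleLT_iff]
  rcases lt_trichotomy (circleParam z) (circleParam w) with h | h | h
  exacts [Or.inl h, Or.inr (Or.inl (circleParam_injective h)), Or.inr (Or.inr h)]

theorem re_coe_lt_one {z : Circle} (hz : z ≠ 1) : (z : ℂ).re < 1 := by
  have h1 : Complex.normSq z = 1 := Circle.normSq_coe z
  rw [Complex.normSq_apply] at h1
  by_contra! h
  have him : (z : ℂ).im = 0 := by nlinarith
  have hre : (z : ℂ).re = 1 := by nlinarith
  exact hz (Circle.ext (Complex.ext (by simpa using hre) (by simpa using him)))

end CircleOrder

/-! ### The signature formula -/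

open Classical in
/-- The contribution of the block `𝒲_lam^k(u)` to the signature at `ζ`. -/
noncomputable def blockSignature (ζ : Circle) (k : ℕ) (lam : Circle) (u : ℤˣ) : ℤ :=
  if Odd k then if CircleLT lam ζ then -(u : ℤ) else if CircleLT ζ lam then u else 0
  else if lam = ζ then u else 0

theorem HVS.IsWBlock.hasInertia {k : ℕ} {X : HVS 1 (Fin k)} {lam ζ : Circle} {u : ℤˣ}
    (h : X.IsWBlock lam u) (hk : 1 ≤ k) (hζ : ζ ≠ 1) :
    HasInertia (pencil (1 - star (ζ : ℂ)) X.V) (blockSignature ζ k lam u) := by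
  rw [blockSignature]
  have hre := re_coe_lt_one hζ
  rcases h with ⟨hlam, h⟩ | ⟨rfl, h⟩
  · refine h.hasInertia ?_
    rcases circleLT_trichotomy lam ζ with hlt | rfl | hlt
    · have hD := im_neg_of_circleLT hlam hlt
      have := h.1.hasInertia_of_im_ne_zero hk hD.ne
      have hne : lam ≠ ζ := by rintro rfl; rw [circleLT_iff] at hlt; exact lt_irrefl _ hlt
      rw [if_pos hD] at this
      rwa [if_pos hlt, if_neg hne]
    · have hD : ((1 - star (lam : ℂ)) * (1 - (lam : ℂ))).im = 0 := by
        rw [im_one_sub_star_mul_one_sub]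
        simp
      have hirr : ¬ CircleLT lam lam := by rw [circleLT_iff]; exact lt_irrefl _
      -- Here `(1 - ζ̄) ζ = ζ - 1`, whose real part is negative.
      have hE : ((1 - star (lam : ℂ)) * (lam : ℂ)).re < 0 := by
        have h1 : star (lam : ℂ) * (lam : ℂ) = 1 := by
          rw [Complex.star_def, ← Complex.normSq_eq_conj_mul_self, Circle.normSq_coe,
            Complex.ofReal_one]
        rw [sub_mul, h1, one_mul, Complex.sub_re, Complex.one_re]
        linarith
      simpa [hirr] using h.1.hasInertia_of_im_eq_zero hk hD hE
    · have hD := im_pos_of_circleLT hζ hlt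
      have := h.1.hasInertia_of_im_ne_zero hk hD.ne'
      have hne : lam ≠ ζ := by rintro rfl; rw [circleLT_iff] at hlt; exact lt_irrefl _ hlt
      have hnlt : ¬ CircleLT lam ζ := by rw [circleLT_iff] at hlt ⊢; exact hlt.not_gt
      rw [if_neg hD.not_gt] at this
      rwa [if_neg hnlt, if_pos hlt, if_neg hne]
  · have hα : 0 < (1 - star (ζ : ℂ)).re := by
      rw [Complex.star_def, Complex.sub_re, Complex.conj_re, Complex.one_re]
      linarith
    -- The eigenvalue `1` is the least element of the order, so its blocks always count among those
    -- with `lam < ζ`.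
    have hlt : CircleLT 1 ζ := by
      rw [circleLT_iff, circleParam_one]
      exact circleParam_pos hζ
    simpa [hlt, hζ.symm] using h.hasInertia hk hα

open Classical in
-- A weighted sum of multiplicities is a sum over the blocks themselves. Only the finitely many
-- values of `f` contribute. The condition `P` serves for the third sum, where the eigenvalue is
-- fixed and is not part of the index.
theorem finsum_mem_mul_card {J X : Type} [Fintype J] (f : J → X) (P : J → Prop) (T : Set X)
    (g : X → ℤ) (c : X → ℕ) (hc : ∀ x ∈ T, c x = Nat.card {j // P j ∧ f j = x}) :
    ∑ᶠ x ∈ T, g x * (c x : ℤ) = ∑ j, if P j ∧ f j ∈ T then g (f j) else 0 := by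
  have hterm : ∀ x, (∑ᶠ (_ : x ∈ T), g x * (c x : ℤ)) =
      ∑ j, if (P j ∧ f j = x) ∧ x ∈ T then g x else 0 := fun x => by
    by_cases hx : x ∈ T
    · rw [finsum_eq_if, if_pos hx, hc x hx, Nat.card_eq_fintype_card, Fintype.card_subtype,
        Finset.card_filter]
      push_cast
      rw [Finset.mul_sum]
      exact Finset.sum_congr rfl fun j _ => by simp [hx]
    · simp [hx]
  simp only [hterm]
  rw [finsum_eq_sum_of_support_subset (s := Finset.univ.image f), Finset.sum_comm]
  · refine Finset.sum_congr rfl fun j _ => ?_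
    rw [Finset.sum_eq_single (f j)]
    · simp
    · intro x _ hx
      simp [hx.symm]
    · simp
  · intro x hx
    rw [Function.mem_support] at hx
    obtain ⟨j, -, hj⟩ := Finset.exists_ne_zero_of_sum_ne_zero hx
    have : f j = x := by
      by_contra h
      simp [h] at hj
    simp [← this]

theorem proposition4p8 (L : OrientedLink) {m : ℕ} (S : Matrix (Fin m) (Fin m) ℤ)
    (hS : IsSeifertMatrix L S)
    {r : ℕ} (N : Matrix (Fin r) (Fin r) ℝ)
    (hN : IsNondegeneratePart (S.map (Int.cast : ℤ → ℝ)) N)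
    (q : ℕ → ℂ → ℕ) (p : ℕ → Circle → ℤˣ → ℕ)
    (hqp : (HVS.ofSeifert N hN.1).IsHNumbers q p)
    (ζ : Circle) (hζ : ζ ≠ 1) :
    tristramLevine S ζ = tristramLevine S (ζ⁻¹) ∧
    tristramLevine S ζ =
      -(∑ᶠ x ∈ {x : Circle × ℕ × ℤˣ | CircleLT x.1 ζ ∧ Odd x.2.1},
          (x.2.2 : ℤ) * (p x.2.1 x.1 x.2.2 : ℤ))
      + (∑ᶠ x ∈ {x : Circle × ℕ × ℤˣ | CircleLT ζ x.1 ∧ Odd x.2.1},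
          (x.2.2 : ℤ) * (p x.2.1 x.1 x.2.2 : ℤ))
      + (∑ᶠ x ∈ {x : ℕ × ℤˣ | Even x.1}, (x.2 : ℤ) * (p x.1 ζ x.2 : ℤ)) := by
  classical
  refine ⟨(tristramLevine_inv S ζ).symm, ?_⟩
  -- Passing to `ζ⁻¹` makes the coefficient `α = 1 - ζ̄`. With it the degenerate eigenvalue is `ζ`
  -- itself and not `ζ̄`.
  rw [← tristramLevine_inv S ζ]
  obtain ⟨s, t, a, μ, c, lam, u, A, B, hA, hB, hiso, -, hp⟩ := hqp
  have hinv : ((ζ⁻¹ : Circle) : ℂ) = star (ζ : ℂ) := Circle.coe_inv_eq_conj ζ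
  have hα : 1 - star (ζ : ℂ) ≠ 0 := by
    rw [← hinv, sub_ne_zero]
    exact fun h => hζ (inv_eq_one.1 (Circle.ext (by simpa using h.symm)))
  have hsum := HVS.hasInertia_directSum
    (HVS.hasInertia_iDirectSum fun i => (hA i).2.2.2.hasInertia (α := 1 - star (ζ : ℂ)))
    (HVS.hasInertia_iDirectSum fun j => (hB j).2.hasInertia (hB j).1 hζ)
  have hσ := (((hiso.hasInertia hsum).of_ofSeifert hN.1).of_isNondegeneratePart hα hN)
  rw [← hinv, ← seifertForm_eq_realPencil] at hσ
  rw [tristramLevine, hσ.signature_eq, Finset.sum_const_zero, zero_add,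
    finsum_mem_mul_card (fun j => (lam j, c j, u j)) (fun _ => True) _ (fun x => (x.2.2 : ℤ))
      (fun x => p x.2.1 x.1 x.2.2),
    finsum_mem_mul_card (fun j => (lam j, c j, u j)) (fun _ => True) _ (fun x => (x.2.2 : ℤ))
      (fun x => p x.2.1 x.1 x.2.2),
    finsum_mem_mul_card (fun j => (c j, u j)) (fun j => lam j = ζ) _ (fun x => (x.2 : ℤ))
      (fun x => p x.1 ζ x.2), ← Finset.sum_neg_distrib, ← Finset.sum_add_distrib,
    ← Finset.sum_add_distrib]
  · refine Finset.sum_congr rfl fun j _ => ?_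
    have hasymm : CircleLT (lam j) ζ → ¬ CircleLT ζ (lam j) := by
      simp only [circleLT_iff]
      exact fun h => h.not_gt
    simp only [blockSignature, Set.mem_ofPred_eq, true_and]
    by_cases hodd : Odd (c j)
    · have heven : ¬ Even (c j) := Nat.not_even_iff_odd.2 hodd
      by_cases h : CircleLT (lam j) ζ
      · simp [hodd, h, hasymm h]
      · simp [hodd, h]
    · simp [hodd, Nat.not_odd_iff_even.1 hodd]
  · rintro ⟨k, v⟩ -
    rw [hp]
    exact Nat.card_congr (Equiv.subtypeEquivRight fun j => by simp only [Prod.mk.injEq]; tauto)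
  · rintro ⟨z, k, v⟩ -
    rw [hp]
    exact Nat.card_congr (Equiv.subtypeEquivRight fun j => by simp only [Prod.mk.injEq]; tauto)
  · rintro ⟨z, k, v⟩ -
    rw [hp]
    exact Nat.card_congr (Equiv.subtypeEquivRight fun j => by simp only [Prod.mk.injEq]; tauto)
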